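/- **Conventions.** Let $R$ be a commutative ring. An $R$-module $C$ is *semidualizing* if it has a (possibly infinite) resolution by finite rank free modules, the homothety map $R\to\operatorname{Hom}_R(C,C)$ is bijective, and $\operatorname{Ext}^{i}_R(C,C)=0$ for all $i\ge 1$. Fix such a $C$. Let $\mathcal P_C$ be the class of modules isomorphic to $P\otimes_R C$ with $P$ projective, and $\mathcal I_C$ the class of modules isomorphic to $\operatorname{Hom}_R(C,I)$ with $I$ injective. Let $\mathcal{GP}_C$ be the class of modules isomorphic to $\operatorname{Coker}(X_1\to X_0)$ for some exact complex $X$ such that $\operatorname{Hom}_R(X,Q)$ is exact for every $Q\in\mathcal P_C$, with $X_i$ projective for $i\ge 0$ and $X_i\in\mathcal P_C$ for $i<0$. Dually, let $\mathcal{GI}_C$ be the class of modules isomorphic to $\operatorname{Ker}(Y^0\to Y^1)$ for some exact cochain complex $Y$ such that $\operatorname{Hom}_R(J,Y)$ is exact for every $J\in\mathcal I_C$, with $Y^i$ injective for $i\ge 0$ and $Y^i\in\mathcal I_C$ for $i<0$. Let $\mathcal X$ be a class of modules. An *$\mathcal X$-resolution* of $M$ is an exact sequence $\cdots\to X_1\to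 X_0\to M\to 0$ with all $X_n\in\mathcal X$; it is *proper* if it stays exact under $\operatorname{Hom}_R(X',-)$ for every $X'\in\mathcal X$. (Proper) $\mathcal X$-coresolutions $0\to N\to X^0\to X^1\to\cdots$ are defined dually, with $\operatorname{Hom}_R(-,X')$. A module has finite $\mathcal X$-projective (resp. $\mathcal X$-injective) dimension if it has an $\mathcal X$-resolution (resp. $\mathcal X$-coresolution), not assumed proper, with only finitely many nonzero terms. If $X$ is a proper $\mathcal X$-resolution of $M$, put $\operatorname{Ext}^n_{\mathcal X}(M,N)=H^n(\operatorname{Hom}_R(X,N))$ for $\mathcal X=\mathcal P_C,\mathcal{GP}_C$; if $Y$ is a proper $\mathcal Y$-coresolution of $N$, put $\operatorname{Ext}^n_{\mathcal Y}(M,N)=H^n(\operatorname{Hom}_R(M,Y))$ for $\mathcal Y=\mathcal I_C,\mathcal{GI}_C$. **Proposition.** Let $C$, $M$, $N$ be $R$-modules with $C$ semidualizing. (a) Suppose that $M$ has a proper $\mathcal{GP}_C$-resolution and a proper $\mathcal P_C$-resolution and that $N$ has finite $\mathcal P_C$-projective dimension. Let $G$ be any proper $\mathcal{GP}_C$-resolution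 and $W$ any proper $\mathcal P_C$-resolution of $M$. Then $\operatorname{id}_M$ lifts to a chain map $f\colon W\to G$, the map $$\vartheta^n=H^n(\operatorname{Hom}_R(f,N))\colon \operatorname{Ext}^n_{\mathcal{GP}_C}(M,N)\to\operatorname{Ext}^n_{\mathcal P_C}(M,N)$$ does not depend on the choice of the lift $f$, and $\vartheta^n$ is an isomorphism for every $n\ge 0$. (b) Suppose that $M$ has finite $\mathcal I_C$-injective dimension, that $N$ has a proper $\mathcal I_C$-coresolution, and that $N$ has a proper $\mathcal{GI}_C$-coresolution (so that $\operatorname{Ext}^n_{\mathcal{GI}_C}(M,N)$ is defined). Let $H$ be any proper $\mathcal{GI}_C$-coresolution and $V$ any proper $\mathcal I_C$-coresolution of $N$. Then $\operatorname{id}_N$ extends to a chain map $g\colon H\to V$, the map $$\vartheta^n=H^n(\operatorname{Hom}_R(M,g))\colon \operatorname{Ext}^n_{\mathcal{GI}_C}(M,N)\to\operatorname{Ext}^n_{\mathcal I_C}(M,N)$$ does not depend on the choice of $g$, and $\vartheta^n$ is an isomorphism for every $n\ge 0$. -/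

import Mathlib

open CategoryTheory CategoryTheory.Limits Opposite

universe u

namespace RelCohomology

variable {R : Type u} [CommRing R]

/-! ### Hom-complexes -/

section HomComplexes

variable {ι : Type} {c : ComplexShape ι}

/-- The complex `Hom_R(M, K)` of `R`-modules, for a module `M` and a complex `K`;
in degree `i` it is `Hom_R(M, K_i)`. -/
noncomputable abbrev homFrom (M : ModuleCat.{u} R) (K : HomologicalComplex (ModuleCat.{u} R) c) :
    HomologicalComplex (ModuleCat.{u} R) c :=
  (((linearCoyoneda R (ModuleCat.{u} R)).obj (op M)).mapHomologicalComplex c).obj K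

/-- The morphism `Hom_R(M, f) : Hom_R(M, K) ⟶ Hom_R(M, L)` induced by `f : K ⟶ L`. -/
noncomputable abbrev homFromMap (M : ModuleCat.{u} R)
    {K L : HomologicalComplex (ModuleCat.{u} R) c} (f : K ⟶ L) : homFrom M K ⟶ homFrom M L :=
  (((linearCoyoneda R (ModuleCat.{u} R)).obj (op M)).mapHomologicalComplex c).map f

/-- The complex `Hom_R(K, N)` of `R`-modules, for a complex `K` and a module `N`;
in degree `i` it is `Hom_R(K_i, N)`, and the differentials go in the direction opposite to `K`. -/
noncomputable abbrev homTo (K : HomologicalComplex (ModuleCat.{u} R) c) (N : ModuleCat.{u} R) :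
    HomologicalComplex (ModuleCat.{u} R) c.symm :=
  (((linearYoneda R (ModuleCat.{u} R)).obj N).mapHomologicalComplex c.symm).obj K.op

/-- The morphism `Hom_R(f, N) : Hom_R(L, N) ⟶ Hom_R(K, N)` induced by `f : K ⟶ L`. -/
noncomputable abbrev homToMap {K L : HomologicalComplex (ModuleCat.{u} R) c} (f : K ⟶ L)
    (N : ModuleCat.{u} R) : homTo L N ⟶ homTo K N :=
  (((linearYoneda R (ModuleCat.{u} R)).obj N).mapHomologicalComplex c.symm).map
    ((HomologicalComplex.opFunctor (ModuleCat.{u} R) c).map f.op)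

/-- `K` is `Hom_R(𝒳, -)`-exact: `Hom_R(X, K)` is exact for every `X` in `𝒳`. -/
def HomFromExact (𝒳 : ObjectProperty (ModuleCat.{u} R))
    (K : HomologicalComplex (ModuleCat.{u} R) c) : Prop :=
  ∀ X : ModuleCat.{u} R, 𝒳 X → (homFrom X K).Acyclic

/-- `K` is `Hom_R(-, 𝒳)`-exact: `Hom_R(K, X)` is exact for every `X` in `𝒳`. -/
def HomToExact (𝒳 : ObjectProperty (ModuleCat.{u} R))
    (K : HomologicalComplex (ModuleCat.{u} R) c) : Prop :=
  ∀ X : ModuleCat.{u} R, 𝒳 X → (homTo K X).Acyclic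

end HomComplexes

/-! ### Resolutions and coresolutions -/

/-- An `𝒳`-resolution of `M`: a complex `⋯ ⟶ X₁ ⟶ X₀` of modules in `𝒳` with an augmentation
`X₀ ⟶ M` such that `⋯ ⟶ X₁ ⟶ X₀ ⟶ M ⟶ 0` is exact. -/
structure Resolution (𝒳 : ObjectProperty (ModuleCat.{u} R)) (M : ModuleCat.{u} R) where
  complex : ChainComplex (ModuleCat.{u} R) ℕ
  aug : complex.X 0 ⟶ M
  d_aug : complex.d 1 0 ≫ aug = 0
  mem : ∀ n, 𝒳 (complex.X n)
  exact : (complex.augment aug d_aug).Acyclic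

/-- The augmented resolution `⋯ ⟶ X₁ ⟶ X₀ ⟶ M ⟶ 0` (here `M` sits in degree `0`). -/
noncomputable abbrev Resolution.augmented {𝒳 : ObjectProperty (ModuleCat.{u} R)}
    {M : ModuleCat.{u} R} (X : Resolution 𝒳 M) : ChainComplex (ModuleCat.{u} R) ℕ :=
  X.complex.augment X.aug X.d_aug

/-- A proper `𝒳`-resolution: the augmented resolution is `Hom_R(𝒳, -)`-exact. -/
structure ProperResolution (𝒳 : ObjectProperty (ModuleCat.{u} R)) (M : ModuleCat.{u} R)
    extends Resolution 𝒳 M where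
  proper : HomFromExact 𝒳 toResolution.augmented

/-- `M` has finite `𝒳`-projective dimension: it has an `𝒳`-resolution `X` such that
`X_n = 0` for all large `n`. -/
def FinitePd (𝒳 : ObjectProperty (ModuleCat.{u} R)) (M : ModuleCat.{u} R) : Prop :=
  ∃ (X : Resolution 𝒳 M) (d : ℕ), ∀ n, d < n → IsZero (X.complex.X n)

/-- A `𝒴`-coresolution of `N`: a complex `Y⁰ ⟶ Y¹ ⟶ ⋯` of modules in `𝒴` with a coaugmentation
`N ⟶ Y⁰` such that `0 ⟶ N ⟶ Y⁰ ⟶ Y¹ ⟶ ⋯` is exact. -/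
structure Coresolution (𝒴 : ObjectProperty (ModuleCat.{u} R)) (N : ModuleCat.{u} R) where
  complex : CochainComplex (ModuleCat.{u} R) ℕ
  coaug : N ⟶ complex.X 0
  coaug_d : coaug ≫ complex.d 0 1 = 0
  mem : ∀ n, 𝒴 (complex.X n)
  exact : (complex.augment coaug coaug_d).Acyclic

/-- The augmented coresolution `0 ⟶ N ⟶ Y⁰ ⟶ Y¹ ⟶ ⋯` (here `N` sits in degree `0`). -/
noncomputable abbrev Coresolution.augmented {𝒴 : ObjectProperty (ModuleCat.{u} R)}
    {N : ModuleCat.{u} R} (Y : Coresolution 𝒴 N) : CochainComplex (ModuleCat.{u} R) ℕ :=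
  Y.complex.augment Y.coaug Y.coaug_d

/-- A proper `𝒴`-coresolution: the augmented coresolution is `Hom_R(-, 𝒴)`-exact. -/
structure ProperCoresolution (𝒴 : ObjectProperty (ModuleCat.{u} R)) (N : ModuleCat.{u} R)
    extends Coresolution 𝒴 N where
  proper : HomToExact 𝒴 toCoresolution.augmented

/-- `N` has finite `𝒴`-injective dimension: it has a `𝒴`-coresolution `Y` such that
`Y^n = 0` for all large `n`. -/
def FiniteId (𝒴 : ObjectProperty (ModuleCat.{u} R)) (N : ModuleCat.{u} R) : Prop :=
  ∃ (Y : Coresolution 𝒴 N) (d : ℕ), ∀ n, d < n → IsZero (Y.complex.X n)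

/-! ### Relative cohomology and the comparison maps -/

section RelativeExt

variable {𝒳 𝒲 𝒴 𝒱 : ObjectProperty (ModuleCat.{u} R)} {M N : ModuleCat.{u} R}

/-- The relative cohomology module `Ext^n_{𝒳R}(M, N)`, computed by the proper `𝒳`-resolution
`X` of `M`: the cohomology of `Hom_R(X, N)` in degree `n`. -/
noncomputable abbrev extLeft (X : ProperResolution 𝒳 M) (N : ModuleCat.{u} R) (n : ℕ) :
    ModuleCat.{u} R :=
  (homTo X.complex N).homology n

/-- The relative cohomology module `Ext^n_{R𝒴}(M, N)`, computed by the proper `𝒴`-coresolution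
`Y` of `N`: the cohomology of `Hom_R(M, Y)` in degree `n`. -/
noncomputable abbrev extRight (M : ModuleCat.{u} R) (Y : ProperCoresolution 𝒴 N) (n : ℕ) :
    ModuleCat.{u} R :=
  (homFrom M Y.complex).homology n

/-- The chain map `f : W ⟶ X` between resolutions of `M` lifts the identity of `M`. -/
def LiftsId (W : ProperResolution 𝒲 M) (X : ProperResolution 𝒳 M)
    (f : W.complex ⟶ X.complex) : Prop :=
  f.f 0 ≫ X.aug = W.aug

/-- `θ` is the comparison map `ϑ^n : Ext^n_{𝒳R}(M, N) ⟶ Ext^n_{𝒲R}(M, N)`: the identity of `M`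
lifts to a chain map `W ⟶ X`, and `θ` is the map in cohomology induced by `Hom_R(f, N)`
for each such lift `f`. (In particular there is at most one such `θ`.) -/
def IsTheta (X : ProperResolution 𝒳 M) (W : ProperResolution 𝒲 M) (N : ModuleCat.{u} R) (n : ℕ)
    (θ : extLeft X N n ⟶ extLeft W N n) : Prop :=
  (∃ f : W.complex ⟶ X.complex, LiftsId W X f) ∧
  ∀ f : W.complex ⟶ X.complex, LiftsId W X f →
    θ = HomologicalComplex.homologyMap (homToMap f N) n

/-- The chain map `f : Y ⟶ V` between coresolutions of `N` extends the identity of `N`. -/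
def ExtendsId (Y : ProperCoresolution 𝒴 N) (V : ProperCoresolution 𝒱 N)
    (f : Y.complex ⟶ V.complex) : Prop :=
  Y.coaug ≫ f.f 0 = V.coaug

/-- `θ` is the comparison map `ϑ^n : Ext^n_{R𝒴}(M, N) ⟶ Ext^n_{R𝒱}(M, N)`: the identity of `N`
extends to a chain map `Y ⟶ V`, and `θ` is the map in cohomology induced by `Hom_R(M, f)`
for each such extension `f`. (In particular there is at most one such `θ`.) -/
def IsCotheta (M : ModuleCat.{u} R) (Y : ProperCoresolution 𝒴 N) (V : ProperCoresolution 𝒱 N)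
    (n : ℕ) (θ : extRight M Y n ⟶ extRight M V n) : Prop :=
  (∃ f : Y.complex ⟶ V.complex, ExtendsId Y V f) ∧
  ∀ f : Y.complex ⟶ V.complex, ExtendsId Y V f →
    θ = HomologicalComplex.homologyMap (homFromMap M f) n

end RelativeExt

/-! ### Semidualizing modules and the associated classes of modules -/

/-- The finite rank free modules. -/
def finiteFree (R : Type u) [CommRing R] : ObjectProperty (ModuleCat.{u} R) :=
  fun F => Module.Free R F ∧ Module.Finite R F

/-- Semidualizing modules: `C` has a (possibly unbounded) resolution by finite rank free modules,
the homothety map `R → Hom_R(C, C)` is bijective, and `Ext^n_R(C, C) = 0` for all `n ≥ 1`. -/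
structure IsSemidualizing (C : ModuleCat.{u} R) : Prop where
  resolution : Nonempty (Resolution (finiteFree R) C)
  homothety : Function.Bijective (LinearMap.lsmul R C : R →ₗ[R] C →ₗ[R] C)
  ext_eq_zero : ∀ n : ℕ, 1 ≤ n → Subsingleton (Abelian.Ext.{u} C C n)

/-- `𝒫_C`: the modules isomorphic to `P ⊗_R C` for some projective module `P`. -/
def cProjective (C : ModuleCat.{u} R) : ObjectProperty (ModuleCat.{u} R) :=
  fun X => ∃ P : ModuleCat.{u} R, Module.Projective R P ∧ Nonempty (X ≃ₗ[R] TensorProduct R P C)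

/-- `ℐ_C`: the modules isomorphic to `Hom_R(C, I)` for some injective module `I`. -/
def cInjective (C : ModuleCat.{u} R) : ObjectProperty (ModuleCat.{u} R) :=
  fun X => ∃ I : ModuleCat.{u} R, Module.Injective R I ∧ Nonempty (X ≃ₗ[R] (C →ₗ[R] I))

/-- A complete `𝒫𝒫_C`-resolution: an exact and `Hom_R(-, 𝒫_C)`-exact complex `X`
with `X_i` projective for `i ≥ 0` and `C`-projective for `i < 0`. -/
structure IsCompleteResolution (C : ModuleCat.{u} R) (X : ChainComplex (ModuleCat.{u} R) ℤ) :
    Prop where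
  exact : X.Acyclic
  homExact : HomToExact (cProjective C) X
  projective : ∀ i : ℤ, 0 ≤ i → Module.Projective R (X.X i)
  cProj : ∀ i : ℤ, i < 0 → cProjective C (X.X i)

/-- `𝒢𝒫_C`: the modules isomorphic to `Coker(X₁ ⟶ X₀)` for some complete
`𝒫𝒫_C`-resolution `X`. -/
def gcProjective (C : ModuleCat.{u} R) : ObjectProperty (ModuleCat.{u} R) :=
  fun G => ∃ X : ChainComplex (ModuleCat.{u} R) ℤ,
    IsCompleteResolution C X ∧ Nonempty (G ≅ cokernel (X.d 1 0))

/-- A complete `ℐ_Cℐ`-coresolution: an exact and `Hom_R(ℐ_C, -)`-exact (cochain) complex `Y`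
with `Y^i` injective for `i ≥ 0` and `C`-injective for `i < 0`. -/
structure IsCompleteCoresolution (C : ModuleCat.{u} R) (Y : CochainComplex (ModuleCat.{u} R) ℤ) :
    Prop where
  exact : Y.Acyclic
  homExact : HomFromExact (cInjective C) Y
  injective : ∀ i : ℤ, 0 ≤ i → Module.Injective R (Y.X i)
  cInj : ∀ i : ℤ, i < 0 → cInjective C (Y.X i)

/-- `𝒢ℐ_C`: the modules isomorphic to `Ker(Y⁰ ⟶ Y¹)` for some complete
`ℐ_Cℐ`-coresolution `Y`. -/
def gcInjective (C : ModuleCat.{u} R) : ObjectProperty (ModuleCat.{u} R) :=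
  fun G => ∃ Y : CochainComplex (ModuleCat.{u} R) ℤ,
    IsCompleteCoresolution C Y ∧ Nonempty (G ≅ kernel (Y.d 0 1))

end RelCohomology

namespace RelCohomology

variable {R : Type u} [CommRing R]

/-! ### Elementwise criteria for exactness and for isomorphisms on homology. -/

section HomologyCriteria

variable {ι : Type} {c : ComplexShape ι}

/-! Two facts about the classes drive part (a); part (b) is dual.

The first is vanishing: if `G` lies in `𝒢𝒫_C` and `N` has finite `𝒫_C`-projective dimension, then
`Ext^i(G, N) = 0` for `i ≥ 1`. For `N` in `𝒫_C`, the half of a complete resolution in degrees `≥ 0`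
is a projective resolution of `G` that stays exact under `Hom(-, N)` (`gcProjective.extVanish`). The
general case follows by dimension shifting along a finite `𝒫_C`-resolution of `N`, which need not be
proper (`gcProjective.extVanish_of_finitePd`).

The second is the inclusion `𝒫_C ≤ 𝒢𝒫_C` (`cProjective_le_gcProjective`). If `F ⟶ C` is a resolution
by finite free modules, then `P ⊗ F ⟶ P ⊗ C ⟶ 0` is a complete resolution. Its `Hom(-, Q ⊗
C)`-exactness comes from `Hom(F, Q ⊗ C) ≅ Q ⊗ Hom(F, C)` and the vanishing of `Ext^i(C, C)`. Dually,
`Hom(C, I)` is coresolved by `Hom(F, I)`, and tensor evaluation `Hom(C, J) ⊗ F ≅ Hom(Hom(F, C), J)`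
provides the exactness under Hom (`cInjective_le_gcInjective`).

By the inclusion, the terms of `W` can be lifted along the proper resolution `G`, so lifts of the
identity exist and are unique up to homotopy. Both augmented resolutions are exact, hence the
mapping cone of a lift `f` is exact. Its terms have no higher Ext into `N`, so it stays exact under
`Hom(-, N)`, and this says that `Hom(f, N)` is an isomorphism on cohomology
(`isIso_homologyMap_homToMap`). -/

theorem exactAt_iff_forall (K : HomologicalComplex (ModuleCat.{u} R) c) {i j k : ι}
    (hi : c.prev j = i) (hk : c.next j = k) :
    K.ExactAt j ↔ ∀ x : K.X j, K.d j k x = 0 → ∃ y : K.X i, K.d i j y = x := by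
  rw [K.exactAt_iff' i j k hi hk, ShortComplex.moduleCat_exact_iff]
  rfl

theorem homTo_exactAt_iff (K : HomologicalComplex (ModuleCat.{u} R) c) (N : ModuleCat.{u} R)
    {i j k : ι} (hi : c.prev j = i) (hk : c.next j = k) :
    (homTo K N).ExactAt j ↔
      ∀ φ : K.X j ⟶ N, K.d i j ≫ φ = 0 → ∃ ψ : K.X k ⟶ N, K.d j k ≫ ψ = φ :=
  exactAt_iff_forall (homTo K N) (i := k) (k := i) hk hi

theorem homFrom_exactAt_iff (M : ModuleCat.{u} R) (K : HomologicalComplex (ModuleCat.{u} R) c)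
    {i j k : ι} (hi : c.prev j = i) (hk : c.next j = k) :
    (homFrom M K).ExactAt j ↔
      ∀ φ : M ⟶ K.X j, φ ≫ K.d j k = 0 → ∃ ψ : M ⟶ K.X i, ψ ≫ K.d i j = φ :=
  exactAt_iff_forall (homFrom M K) hi hk

theorem exists_homologyπ_eq (K : HomologicalComplex (ModuleCat.{u} R) c) {j : ι} (k : ι)
    (a : K.homology j) :
    ∃ z : K.cycles j, K.homologyπ j z = a ∧ K.d j k (K.iCycles j z) = 0 := by
  obtain ⟨z, rfl⟩ := (ModuleCat.epi_iff_surjective (K.homologyπ j)).1 inferInstance a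
  refine ⟨z, rfl, ?_⟩
  rw [← ModuleCat.comp_apply, K.iCycles_d]
  rfl

theorem exists_iCycles_eq (K : HomologicalComplex (ModuleCat.{u} R) c) {j k : ι}
    (hk : c.next j = k) (x : K.X j) (hx : K.d j k x = 0) :
    ∃ z : K.cycles j, K.iCycles j z = x :=
  ⟨K.cyclesMk x k hk hx, K.i_cyclesMk x k hk hx⟩

theorem homologyπ_eq_zero_iff (K : HomologicalComplex (ModuleCat.{u} R) c) {i j : ι}
    (hi : c.prev j = i) (z : K.cycles j) :
    K.homologyπ j z = 0 ↔ ∃ y : K.X i, K.d i j y = K.iCycles j z := by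
  have hex : (ShortComplex.mk (K.toCycles i j) (K.homologyπ j) (by simp)).Exact :=
    ShortComplex.exact_of_g_is_cokernel _ (K.homologyIsCokernel i j hi)
  have hinj := (ModuleCat.mono_iff_injective (K.iCycles j)).1 inferInstance
  have hd (y : K.X i) : K.iCycles j (K.toCycles i j y) = K.d i j y := by
    rw [← ModuleCat.comp_apply, K.toCycles_i]
  rw [ShortComplex.moduleCat_exact_iff] at hex
  constructor
  · intro h
    obtain ⟨y, hy⟩ := hex z h
    exact ⟨y, by rw [← hd]; exact congrArg _ hy⟩
  · rintro ⟨y, hy⟩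
    have : K.toCycles i j y = z := hinj (by rw [hd, hy])
    rw [← this, ← ModuleCat.comp_apply, K.toCycles_comp_homologyπ]
    rfl

/-- The criterion also covers the end of a complex: there `c.prev j = j` and the differential `d j
j` vanishes, so "boundary" means "zero". -/
theorem isIso_homologyMap {K L : HomologicalComplex (ModuleCat.{u} R) c} (φ : K ⟶ L) {i j k : ι}
    (hi : c.prev j = i) (hk : c.next j = k)
    (inj : ∀ x : K.X j, K.d j k x = 0 → ∀ y : L.X i, φ.f j x = L.d i j y →
      ∃ z : K.X i, K.d i j z = x)
    (surj : ∀ y : L.X j, L.d j k y = 0 →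
      ∃ x : K.X j, K.d j k x = 0 ∧ ∃ z : L.X i, L.d i j z = φ.f j x - y) :
    IsIso (HomologicalComplex.homologyMap φ j) := by
  have hnat (z : K.cycles j) : HomologicalComplex.homologyMap φ j (K.homologyπ j z) =
      L.homologyπ j (HomologicalComplex.cyclesMap φ j z) := by
    rw [← ModuleCat.comp_apply, HomologicalComplex.homologyπ_naturality, ModuleCat.comp_apply]
  have hcyc (z : K.cycles j) : L.iCycles j (HomologicalComplex.cyclesMap φ j z) =
      φ.f j (K.iCycles j z) := by
    rw [← ModuleCat.comp_apply, HomologicalComplex.cyclesMap_i, ModuleCat.comp_apply]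
  rw [ConcreteCategory.isIso_iff_bijective]
  constructor
  · rw [injective_iff_map_eq_zero]
    intro a ha
    obtain ⟨z, rfl, hz⟩ := exists_homologyπ_eq K k a
    rw [hnat, homologyπ_eq_zero_iff L hi] at ha
    obtain ⟨y, hy⟩ := ha
    rw [homologyπ_eq_zero_iff K hi]
    exact inj _ hz y (by rw [hy, hcyc])
  · intro b
    obtain ⟨w, rfl, hw⟩ := exists_homologyπ_eq L k b
    obtain ⟨x, hx, z, hz⟩ := surj _ hw
    obtain ⟨v, rfl⟩ := exists_iCycles_eq K hk x hx
    refine ⟨K.homologyπ j v, ?_⟩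
    rw [hnat, ← sub_eq_zero, ← map_sub, homologyπ_eq_zero_iff L hi]
    exact ⟨z, by rw [hz, map_sub, hcyc]⟩

end HomologyCriteria

/-! ### Exact sequences indexed by `ℕ` -/

/-- The sequence `⋯ ⟶ X 2 ⟶ X 1 ⟶ X 0 ⟶ 0` is exact. -/
structure IsExactSeq (X : ℕ → ModuleCat.{u} R) (d : ∀ n, X (n + 1) ⟶ X n) : Prop where
  surjective : Function.Surjective (d 0)
  exact : ∀ n, Function.Exact (d (n + 1)) (d n)

/-- The sequence `0 ⟶ X 0 ⟶ X 1 ⟶ X 2 ⟶ ⋯` is exact. -/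
structure IsExactCoseq (X : ℕ → ModuleCat.{u} R) (d : ∀ n, X n ⟶ X (n + 1)) : Prop where
  injective : Function.Injective (d 0)
  exact : ∀ n, Function.Exact (d n) (d (n + 1))

/-- The sequence `X` of modules remains exact under `Hom(-, N)`. -/
def HomToExactSeq (X : ℕ → ModuleCat.{u} R) (d : ∀ n, X (n + 1) ⟶ X n) (N : ModuleCat.{u} R) :
    Prop :=
  ∀ (n : ℕ) (φ : X (n + 1) ⟶ N), d (n + 1) ≫ φ = 0 → ∃ ψ : X n ⟶ N, d n ≫ ψ = φ

/-- The sequence `X` of modules remains exact under `Hom(M, -)`. -/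
def HomFromExactCoseq (X : ℕ → ModuleCat.{u} R) (d : ∀ n, X n ⟶ X (n + 1)) (M : ModuleCat.{u} R) :
    Prop :=
  ∀ (n : ℕ) (φ : M ⟶ X (n + 1)), φ ≫ d (n + 1) = 0 → ∃ ψ : M ⟶ X n, ψ ≫ d n = φ

theorem exact_of_comp_eq_zero {X Y Z : ModuleCat.{u} R} {f : X ⟶ Y} {g : Y ⟶ Z} (w : f ≫ g = 0)
    (h : ∀ y, g y = 0 → ∃ x, f x = y) : Function.Exact f g := by
  refine fun y => ⟨h y, ?_⟩
  rintro ⟨x, rfl⟩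
  rw [← ModuleCat.comp_apply, w]
  rfl

theorem comp_eq_zero_of_exact {X Y Z : ModuleCat.{u} R} {f : X ⟶ Y} {g : Y ⟶ Z}
    (h : Function.Exact f g) : f ≫ g = 0 := by
  ext x
  exact h.apply_apply_eq_zero x

/-! ### From acyclic complexes to exact sequences and lifting properties. -/

section Chain

variable {K : ChainComplex (ModuleCat.{u} R) ℕ}

theorem prev_down (n : ℕ) : (ComplexShape.down ℕ).prev n = n + 1 := by simp

theorem next_down (n : ℕ) : (ComplexShape.down ℕ).next (n + 1) = n := by simp

theorem next_down_zero : (ComplexShape.down ℕ).next 0 = 0 := by simp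

theorem next_up (n : ℕ) : (ComplexShape.up ℕ).next n = n + 1 := by simp

theorem prev_up (n : ℕ) : (ComplexShape.up ℕ).prev (n + 1) = n := by simp

theorem prev_up_zero : (ComplexShape.up ℕ).prev 0 = 0 := by simp

theorem isExactSeq_of_acyclic (hK : K.Acyclic) : IsExactSeq K.X fun n => K.d (n + 1) n where
  -- Degree `0` is its own successor with zero outgoing differential, so exactness there is
  -- surjectivity of `d 1 0`.
  surjective x := (exactAt_iff_forall K (prev_down 0) next_down_zero).1 (hK 0) x (by simp)
  exact n := exact_of_comp_eq_zero (by simp)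
    ((exactAt_iff_forall K (prev_down _) (next_down n)).1 (hK (n + 1)))

theorem exists_lift_of_homFrom_acyclic {M : ModuleCat.{u} R} (hK : (homFrom M K).Acyclic) (n : ℕ)
    (φ : M ⟶ K.X (n + 1)) (hφ : φ ≫ K.d (n + 1) n = 0) :
    ∃ ψ : M ⟶ K.X (n + 2), ψ ≫ K.d (n + 2) (n + 1) = φ :=
  (homFrom_exactAt_iff M K (prev_down _) (next_down n)).1 (hK (n + 1)) φ hφ

theorem exists_lift_zero_of_homFrom_acyclic {M : ModuleCat.{u} R} (hK : (homFrom M K).Acyclic)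
    (φ : M ⟶ K.X 0) : ∃ ψ : M ⟶ K.X 1, ψ ≫ K.d 1 0 = φ :=
  (homFrom_exactAt_iff M K (prev_down 0) next_down_zero).1 (hK 0) φ (by simp)

end Chain

section Cochain

variable {K : CochainComplex (ModuleCat.{u} R) ℕ}

theorem isExactCoseq_of_acyclic (hK : K.Acyclic) : IsExactCoseq K.X fun n => K.d n (n + 1) where
  injective := by
    rw [injective_iff_map_eq_zero]
    intro x hx
    obtain ⟨y, rfl⟩ := (exactAt_iff_forall K prev_up_zero (next_up 0)).1 (hK 0) x hx
    simp
  exact n := exact_of_comp_eq_zero (by simp)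
    ((exactAt_iff_forall K (prev_up n) (next_up _)).1 (hK (n + 1)))

theorem exists_extend_of_homTo_acyclic {N : ModuleCat.{u} R} (hK : (homTo K N).Acyclic) (n : ℕ)
    (φ : K.X (n + 1) ⟶ N) (hφ : K.d n (n + 1) ≫ φ = 0) :
    ∃ ψ : K.X (n + 2) ⟶ N, K.d (n + 1) (n + 2) ≫ ψ = φ :=
  (homTo_exactAt_iff K N (prev_up n) (next_up _)).1 (hK (n + 1)) φ hφ

theorem exists_extend_zero_of_homTo_acyclic {N : ModuleCat.{u} R} (hK : (homTo K N).Acyclic)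
    (φ : K.X 0 ⟶ N) : ∃ ψ : K.X 1 ⟶ N, K.d 0 1 ≫ ψ = φ :=
  (homTo_exactAt_iff K N prev_up_zero (next_up 0)).1 (hK 0) φ (by simp)

end Cochain

/-- `Ext^n(M, N) = 0` for all `n ≥ 1`. -/
def ExtVanish (M N : ModuleCat.{u} R) : Prop :=
  ∀ n : ℕ, Subsingleton (Abelian.Ext.{u} M N (n + 1))

theorem ExtVanish.of_projective (P N : ModuleCat.{u} R) [Module.Projective R P] :
    ExtVanish P N := by
  have : Projective P := (IsProjective.iff_projective P).1 inferInstance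
  exact fun n => Abelian.Ext.subsingleton_of_projective P N n

theorem ExtVanish.of_injective (M I : ModuleCat.{u} R) [Module.Injective R I] :
    ExtVanish M I := by
  have : Injective I := Module.injective_object_of_injective_module R I
  exact fun n => Abelian.Ext.subsingleton_of_injective M I n

theorem isZero_iff_subsingleton (X : ModuleCat.{u} R) : IsZero X ↔ Subsingleton X :=
  ⟨fun h => ModuleCat.subsingleton_of_isZero h, fun _ => ModuleCat.isZero_of_subsingleton X⟩

theorem ExtVanish.of_isZero_left {M N : ModuleCat.{u} R} (h : IsZero M) : ExtVanish M N := by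
  rw [isZero_iff_subsingleton] at h
  exact ExtVanish.of_projective M N

theorem ExtVanish.of_isZero_right {M N : ModuleCat.{u} R} (h : IsZero N) : ExtVanish M N :=
  have : Injective N := h.injective
  fun n => Abelian.Ext.subsingleton_of_injective M N n

/-! ### Long exact Ext sequences and vanishing along a short exact sequence. -/

section ShortExact

variable {X Y Z : ModuleCat.{u} R} {f : X ⟶ Y} {g : Y ⟶ Z}

theorem shortExact_mk (hf : Function.Injective f) (hfg : Function.Exact f g)
    (hg : Function.Surjective g) :
    (ShortComplex.mk f g (comp_eq_zero_of_exact hfg)).ShortExact where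
  exact := (ShortComplex.moduleCat_exact_iff _).2 fun y hy => (hfg y).1 hy
  mono_f := (ModuleCat.mono_iff_injective f).2 hf
  epi_g := (ModuleCat.epi_iff_surjective g).2 hg

open Abelian.Ext

variable (hf : Function.Injective f) (hfg : Function.Exact f g) (hg : Function.Surjective g)
  {M N : ModuleCat.{u} R}

include hf hfg hg

theorem ExtVanish.kernel_left (hY : ExtVanish Y N) (hZ : ExtVanish Z N) : ExtVanish X N := by
  refine fun n => subsingleton_of_forall_eq 0 fun x => ?_
  obtain ⟨y, rfl⟩ := contravariant_sequence_exact₁ (shortExact_mk hf hfg hg) N x (add_comm 1 _)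
    ((hZ _).elim _ _)
  rw [(hY n).elim y 0, Abelian.Ext.comp_zero]

theorem ExtVanish.exists_extend (hZ : ExtVanish Z N) (φ : X ⟶ N) : ∃ ψ : Y ⟶ N, f ≫ ψ = φ := by
  obtain ⟨y, hy⟩ := contravariant_sequence_exact₁ (shortExact_mk hf hfg hg) N (mk₀ φ) (add_comm 1 0)
    ((hZ _).elim _ _)
  obtain ⟨ψ, rfl⟩ := (mk₀_bijective Y N).2 y
  refine ⟨ψ, (mk₀_bijective X N).1 ?_⟩
  rw [← mk₀_comp_mk₀]
  exact hy

/-- Since `Ext¹(Y, N) = 0`, every class comes from some `X ⟶ N` through the connecting map, which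
kills the maps that extend to `Y`. Degree one is separate because `Hom(X, N)` itself need not
vanish. -/
theorem subsingleton_ext_one_left (hY : ExtVanish Y N) (h : ∀ φ : X ⟶ N, ∃ ψ : Y ⟶ N, f ≫ ψ = φ) :
    Subsingleton (Abelian.Ext.{u} Z N 1) := by
  refine subsingleton_of_forall_eq 0 fun z => ?_
  obtain ⟨x, rfl⟩ := contravariant_sequence_exact₃ (shortExact_mk hf hfg hg) N z
    ((hY 0).elim _ _) (add_zero 1)
  obtain ⟨φ, rfl⟩ := (mk₀_bijective X N).2 x
  obtain ⟨ψ, rfl⟩ := h φ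
  rw [← mk₀_comp_mk₀, ← comp_assoc (h₁₂ := add_zero 1) (h₂₃ := add_zero 0) (h := by simp)]
  have := (shortExact_mk hf hfg hg).extClass_comp
  dsimp only at this
  rw [this, Abelian.Ext.zero_comp]

theorem subsingleton_ext_succ_left (hY : ExtVanish Y N) {n : ℕ}
    (hX : Subsingleton (Abelian.Ext.{u} X N n)) : Subsingleton (Abelian.Ext.{u} Z N (n + 1)) := by
  refine subsingleton_of_forall_eq 0 fun z => ?_
  obtain ⟨x, rfl⟩ := contravariant_sequence_exact₃ (shortExact_mk hf hfg hg) N z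
    ((hY n).elim _ _) (add_comm 1 n)
  rw [hX.elim x 0, Abelian.Ext.comp_zero]

theorem ExtVanish.cokernel_right (hX : ExtVanish M X) (hY : ExtVanish M Y) : ExtVanish M Z := by
  refine fun n => subsingleton_of_forall_eq 0 fun z => ?_
  obtain ⟨y, rfl⟩ := covariant_sequence_exact₃ M (shortExact_mk hf hfg hg) z rfl
    ((hX _).elim _ _)
  rw [(hY n).elim y 0, Abelian.Ext.zero_comp]

theorem ExtVanish.exists_lift (hX : ExtVanish M X) (φ : M ⟶ Z) : ∃ ψ : M ⟶ Y, ψ ≫ g = φ := by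
  obtain ⟨y, hy⟩ := covariant_sequence_exact₃ M (shortExact_mk hf hfg hg) (mk₀ φ) rfl
    ((hX _).elim _ _)
  obtain ⟨ψ, rfl⟩ := (mk₀_bijective M Y).2 y
  refine ⟨ψ, (mk₀_bijective M Z).1 ?_⟩
  rw [← mk₀_comp_mk₀]
  exact hy

theorem subsingleton_ext_one_right (hY : ExtVanish M Y)
    (h : ∀ φ : M ⟶ Z, ∃ ψ : M ⟶ Y, ψ ≫ g = φ) : Subsingleton (Abelian.Ext.{u} M X 1) := by
  refine subsingleton_of_forall_eq 0 fun x => ?_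
  obtain ⟨z, rfl⟩ := covariant_sequence_exact₁ M (shortExact_mk hf hfg hg) x
    ((hY 0).elim _ _) (zero_add 1)
  obtain ⟨φ, rfl⟩ := (mk₀_bijective M Z).2 z
  obtain ⟨ψ, rfl⟩ := h φ
  rw [← mk₀_comp_mk₀, comp_assoc (h₁₂ := add_zero 0) (h₂₃ := zero_add 1) (h := by simp)]
  have := (shortExact_mk hf hfg hg).comp_extClass
  dsimp only at this
  rw [this, Abelian.Ext.comp_zero]

theorem subsingleton_ext_succ_right (hY : ExtVanish M Y) {n : ℕ}
    (hZ : Subsingleton (Abelian.Ext.{u} M Z n)) : Subsingleton (Abelian.Ext.{u} M X (n + 1)) := by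
  refine subsingleton_of_forall_eq 0 fun x => ?_
  obtain ⟨z, rfl⟩ := covariant_sequence_exact₁ M (shortExact_mk hf hfg hg) x
    ((hY n).elim _ _) rfl
  rw [hZ.elim z 0, Abelian.Ext.zero_comp]

end ShortExact

/-! ### Dimension shifting along exact sequences -/

section SeqShift

variable (X : ℕ → ModuleCat.{u} R) (d : ∀ n, X (n + 1) ⟶ X n)

/-- The sequence `⋯ ⟶ X 3 ⟶ X 2 ⟶ Ker (X 1 ⟶ X 0)`. -/
def kerSeq : ℕ → ModuleCat.{u} R
  | 0 => ModuleCat.of R (LinearMap.ker (d 0).hom)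
  | n + 1 => X (n + 2)

variable {X d}

/-- The differentials of `kerSeq X d`. -/
def kerSeqD (h : IsExactSeq X d) : ∀ n, kerSeq X d (n + 1) ⟶ kerSeq X d n
  | 0 => ModuleCat.ofHom ((d 1).hom.codRestrict _ fun x => (h.exact 0).apply_apply_eq_zero x)
  | n + 1 => d (n + 2)

/-- The inclusion of `Ker (X 1 ⟶ X 0)` into `X 1`. -/
def kerSeqι (X : ℕ → ModuleCat.{u} R) (d : ∀ n, X (n + 1) ⟶ X n) : kerSeq X d 0 ⟶ X 1 :=
  ModuleCat.ofHom (LinearMap.ker (d 0).hom).subtype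

theorem kerSeqι_injective : Function.Injective (kerSeqι X d) :=
  Subtype.val_injective

theorem kerSeqι_exact : Function.Exact (kerSeqι X d) (d 0) :=
  LinearMap.exact_subtype_ker_map (d 0).hom

theorem IsExactSeq.kerSeq (h : IsExactSeq X d) : IsExactSeq (kerSeq X d) (kerSeqD h) where
  surjective := by
    rintro ⟨x, hx⟩
    obtain ⟨y, rfl⟩ := (h.exact 0 x).1 hx
    exact ⟨y, rfl⟩
  exact
    | 0 => fun x => by
        refine Iff.trans ?_ (h.exact 1 x)
        exact Subtype.ext_iff
    | n + 1 => h.exact (n + 2)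

/-- Replacing `X 1 ⟶ X 0` by its kernel moves the question one place down, and the kernel inherits
Ext-vanishing. The sequence must end in `⟶ 0` for this induction to have a start. -/
theorem IsExactSeq.homToExactSeq {N : ModuleCat.{u} R} (h : IsExactSeq X d)
    (hX : ∀ n, ExtVanish (X n) N) : HomToExactSeq X d N := by
  intro n
  induction n generalizing X with
  | zero =>
    intro φ hφ
    -- The map `φ` kills the image of `d 1`, which is the kernel of `d 0`, so it factors through the
    -- quotient `X 0`.
    refine ⟨ModuleCat.ofHom ((Submodule.liftQ (LinearMap.ker (d 0).hom) φ.hom ?_).comp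
      ((d 0).hom.quotKerEquivOfSurjective h.surjective).symm.toLinearMap), ?_⟩
    · intro x hx
      obtain ⟨y, rfl⟩ := (h.exact 0 x).1 hx
      exact congrArg (fun ψ : X 2 ⟶ N => ψ.hom y) hφ
    · ext x
      have : ((d 0).hom.quotKerEquivOfSurjective h.surjective).symm ((d 0).hom x) =
          Submodule.Quotient.mk x := by
        rw [LinearEquiv.symm_apply_eq]
        rfl
      simp [this]
  | succ n ih =>
    intro φ hφ
    have hK : ∀ m, ExtVanish (RelCohomology.kerSeq X d m) N
      | 0 => ExtVanish.kernel_left kerSeqι_injective kerSeqι_exact h.surjective (hX 1) (hX 0)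
      | m + 1 => hX (m + 2)
    obtain ⟨ψ, hψ⟩ := ih h.kerSeq hK φ hφ
    cases n with
    | succ n => exact ⟨ψ, hψ⟩
    | zero =>
      -- Here `ψ` is defined only on the kernel inside `X 1`; the obstruction to extending it lies
      -- in `Ext¹(X 0, N) = 0`.
      obtain ⟨χ, hχ⟩ := ExtVanish.exists_extend kerSeqι_injective kerSeqι_exact h.surjective
        (hX 0) ψ
      exact ⟨χ, (congrArg (kerSeqD h 0 ≫ ·) hχ).trans hψ⟩

theorem HomToExactSeq.kerSeq {N : ModuleCat.{u} R} (h : IsExactSeq X d) (hN : HomToExactSeq X d N) :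
    HomToExactSeq (kerSeq X d) (kerSeqD h) N
  | 0 => fun φ hφ => by
      obtain ⟨ψ, hψ⟩ := hN 1 φ hφ
      exact ⟨kerSeqι X d ≫ ψ, hψ⟩
  | n + 1 => hN (n + 2)

/-- The sequence resolves `X 0` by `Hom(-, N)`-acyclic modules, so exactness under `Hom(-, N)` is
the vanishing of higher Ext. Passing to syzygies reduces every degree to `Ext¹`. -/
theorem HomToExactSeq.extVanish_zero {N : ModuleCat.{u} R} (hN : HomToExactSeq X d N)
    (h : IsExactSeq X d) (hX : ∀ n, ExtVanish (X (n + 1)) N) : ExtVanish (X 0) N := by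
  intro n
  induction n generalizing X with
  | zero =>
    refine subsingleton_ext_one_left kerSeqι_injective kerSeqι_exact h.surjective (hX 0) ?_
    intro φ
    -- A map on the syzygy is pulled back to a cocycle on `X 2`, extended over `X 1`, and compared
    -- by cancelling the epimorphism from `X 2`.
    obtain ⟨ψ, hψ⟩ := hN 1 (kerSeqD h 0 ≫ φ)
      ((congrArg (· ≫ φ) (comp_eq_zero_of_exact (h.kerSeq.exact 0))).trans zero_comp)
    have : Epi (kerSeqD h 0) := (ModuleCat.epi_iff_surjective _).2 h.kerSeq.surjective
    exact ⟨ψ, (cancel_epi (kerSeqD h 0)).1 hψ⟩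
  | succ n ih =>
    exact subsingleton_ext_succ_left kerSeqι_injective kerSeqι_exact h.surjective (hX 0)
      (ih (hN.kerSeq h) h.kerSeq fun n => hX (n + 1))

/-- Induction on the length: `X 0` is the quotient of `X 1` by a syzygy with a shorter resolution,
and vanishing passes to cokernels of monomorphisms. -/
theorem IsExactSeq.extVanish_of_isZero {M : ModuleCat.{u} R} (h : IsExactSeq X d)
    (hX : ∀ n, ExtVanish M (X (n + 1))) {m : ℕ} (hm : ∀ n, m < n → IsZero (X n)) :
    ExtVanish M (X 0) := by
  induction m generalizing X with
  | zero =>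
    refine ExtVanish.of_isZero_right ?_
    have := (isZero_iff_subsingleton _).1 (hm 1 one_pos)
    exact (isZero_iff_subsingleton _).2 h.surjective.subsingleton
  | succ m ih =>
    refine ExtVanish.cokernel_right kerSeqι_injective kerSeqι_exact h.surjective
      (ih h.kerSeq (fun n => hX (n + 1)) ?_) (hX 0)
    rintro (_ | n) hn
    · simp at hn
    · exact hm (n + 2) (by omega)

end SeqShift

/-! ### Dual dimension shifting, along cosyzygies. -/

section CoseqShift

variable (X : ℕ → ModuleCat.{u} R) (d : ∀ n, X n ⟶ X (n + 1))

/-- The sequence `Coker (X 0 ⟶ X 1) ⟶ X 2 ⟶ X 3 ⟶ ⋯`. -/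
def cokerSeq : ℕ → ModuleCat.{u} R
  | 0 => ModuleCat.of R (X 1 ⧸ LinearMap.range (d 0).hom)
  | n + 1 => X (n + 2)

variable {X d}

/-- The differentials of `cokerSeq X d`. -/
def cokerSeqD (h : IsExactCoseq X d) : ∀ n, cokerSeq X d n ⟶ cokerSeq X d (n + 1)
  | 0 => ModuleCat.ofHom ((LinearMap.range (d 0).hom).liftQ (d 1).hom (by
      rintro _ ⟨x, rfl⟩
      exact (h.exact 0).apply_apply_eq_zero x))
  | n + 1 => d (n + 2)

/-- The projection of `X 1` onto `Coker (X 0 ⟶ X 1)`. -/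
def cokerSeqπ (X : ℕ → ModuleCat.{u} R) (d : ∀ n, X n ⟶ X (n + 1)) : X 1 ⟶ cokerSeq X d 0 :=
  ModuleCat.ofHom (LinearMap.range (d 0).hom).mkQ

theorem cokerSeqπ_surjective : Function.Surjective (cokerSeqπ X d) :=
  Submodule.mkQ_surjective _

theorem cokerSeqπ_exact : Function.Exact (d 0) (cokerSeqπ X d) :=
  LinearMap.exact_map_mkQ_range (d 0).hom

theorem IsExactCoseq.cokerSeq (h : IsExactCoseq X d) :
    IsExactCoseq (cokerSeq X d) (cokerSeqD h) where
  injective := by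
    rw [injective_iff_map_eq_zero]
    intro x hx
    obtain ⟨y, rfl⟩ := cokerSeqπ_surjective x
    exact (cokerSeqπ_exact y).2 ((h.exact 0 y).1 hx)
  exact
    | 0 => fun x => by
        refine (h.exact 1 x).trans ⟨?_, ?_⟩
        · rintro ⟨y, rfl⟩
          exact ⟨cokerSeqπ X d y, rfl⟩
        · rintro ⟨y, rfl⟩
          obtain ⟨z, rfl⟩ := cokerSeqπ_surjective y
          exact ⟨z, rfl⟩
    | n + 1 => h.exact (n + 2)

theorem IsExactCoseq.homFromExactCoseq {M : ModuleCat.{u} R} (h : IsExactCoseq X d)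
    (hX : ∀ n, ExtVanish M (X n)) : HomFromExactCoseq X d M := by
  intro n
  induction n generalizing X with
  | zero =>
    intro φ hφ
    refine ⟨ModuleCat.ofHom ((LinearEquiv.ofInjective (d 0).hom h.injective).symm.toLinearMap.comp
      (φ.hom.codRestrict _ fun x => ?_)), ?_⟩
    · exact (h.exact 0 _).1 (congrArg (fun ψ : M ⟶ X 2 => ψ.hom x) hφ)
    · ext x
      exact congrArg Subtype.val
        ((LinearEquiv.ofInjective (d 0).hom h.injective).apply_symm_apply ⟨φ.hom x, _⟩)
  | succ n ih =>
    intro φ hφ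
    have hK : ∀ m, ExtVanish M (RelCohomology.cokerSeq X d m)
      | 0 => ExtVanish.cokernel_right h.injective cokerSeqπ_exact cokerSeqπ_surjective (hX 0) (hX 1)
      | m + 1 => hX (m + 2)
    obtain ⟨ψ, hψ⟩ := ih h.cokerSeq hK φ hφ
    cases n with
    | succ n => exact ⟨ψ, hψ⟩
    | zero =>
      obtain ⟨χ, hχ⟩ := ExtVanish.exists_lift h.injective cokerSeqπ_exact cokerSeqπ_surjective
        (hX 0) ψ
      exact ⟨χ, (congrArg (· ≫ cokerSeqD h 0) hχ).trans hψ⟩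

theorem HomFromExactCoseq.cokerSeq {M : ModuleCat.{u} R} (h : IsExactCoseq X d)
    (hM : HomFromExactCoseq X d M) : HomFromExactCoseq (cokerSeq X d) (cokerSeqD h) M
  | 0 => fun φ hφ => by
      obtain ⟨ψ, hψ⟩ := hM 1 φ hφ
      exact ⟨ψ ≫ cokerSeqπ X d, hψ⟩
  | n + 1 => hM (n + 2)

/-- Dual reduction: cosyzygies bring every degree to `Ext¹`, where maps into a cosyzygy lift because
the sequence stays exact under `Hom(M, -)`. -/
theorem HomFromExactCoseq.extVanish_zero {M : ModuleCat.{u} R} (hM : HomFromExactCoseq X d M)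
    (h : IsExactCoseq X d) (hX : ∀ n, ExtVanish M (X (n + 1))) : ExtVanish M (X 0) := by
  intro n
  induction n generalizing X with
  | zero =>
    refine subsingleton_ext_one_right h.injective cokerSeqπ_exact cokerSeqπ_surjective (hX 0) ?_
    intro φ
    obtain ⟨ψ, hψ⟩ := hM 1 (φ ≫ cokerSeqD h 0)
      ((congrArg (φ ≫ ·) (comp_eq_zero_of_exact (h.cokerSeq.exact 0))).trans comp_zero)
    have : Mono (cokerSeqD h 0) := (ModuleCat.mono_iff_injective _).2 h.cokerSeq.injective
    exact ⟨ψ, (cancel_mono (cokerSeqD h 0)).1 hψ⟩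
  | succ n ih =>
    exact subsingleton_ext_succ_right h.injective cokerSeqπ_exact cokerSeqπ_surjective (hX 0)
      (ih (hM.cokerSeq h) h.cokerSeq fun n => hX (n + 1))

theorem IsExactCoseq.extVanish_of_isZero {N : ModuleCat.{u} R} (h : IsExactCoseq X d)
    (hX : ∀ n, ExtVanish (X (n + 1)) N) {m : ℕ} (hm : ∀ n, m < n → IsZero (X n)) :
    ExtVanish (X 0) N := by
  induction m generalizing X with
  | zero =>
    refine ExtVanish.of_isZero_left ?_
    have := (isZero_iff_subsingleton _).1 (hm 1 one_pos)
    exact (isZero_iff_subsingleton _).2 h.injective.subsingleton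
  | succ m ih =>
    refine ExtVanish.kernel_left h.injective cokerSeqπ_exact cokerSeqπ_surjective
      (hX 0) (ih h.cokerSeq (fun n => hX (n + 1)) ?_)
    rintro (_ | n) hn
    · simp at hn
    · exact hm (n + 2) (by omega)

end CoseqShift

/-! ### Lifts between proper resolutions and the mapping cone argument. -/

section Comparison

section ShortExact

variable {X Y Z : ModuleCat.{u} R} {f : X ⟶ Y} {g : Y ⟶ Z}
  (hf : Function.Injective f) (hfg : Function.Exact f g) (hg : Function.Surjective g)
  {M N : ModuleCat.{u} R}

include hf hfg hg

theorem ExtVanish.middle_left (hX : ExtVanish X N) (hZ : ExtVanish Z N) : ExtVanish Y N := by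
  refine fun n => subsingleton_of_forall_eq 0 fun y => ?_
  obtain ⟨z, rfl⟩ := Abelian.Ext.contravariant_sequence_exact₂ (shortExact_mk hf hfg hg) N y
    ((hX n).elim _ _)
  rw [(hZ n).elim z 0, Abelian.Ext.comp_zero]

theorem ExtVanish.middle_right (hX : ExtVanish M X) (hZ : ExtVanish M Z) : ExtVanish M Y := by
  refine fun n => subsingleton_of_forall_eq 0 fun y => ?_
  obtain ⟨x, rfl⟩ := Abelian.Ext.covariant_sequence_exact₂ M (shortExact_mk hf hfg hg) y
    ((hZ n).elim _ _)
  rw [(hX n).elim x 0, Abelian.Ext.zero_comp]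

end ShortExact

theorem ExtVanish.prod_left {A B N : ModuleCat.{u} R} (hA : ExtVanish A N) (hB : ExtVanish B N) :
    ExtVanish (ModuleCat.of R (A × B)) N :=
  ExtVanish.middle_left (f := ModuleCat.ofHom (LinearMap.inl R A B))
    (g := ModuleCat.ofHom (LinearMap.snd R A B)) LinearMap.inl_injective
    (Function.Exact.inl_snd) LinearMap.snd_surjective hA hB

theorem ExtVanish.prod_right {M A B : ModuleCat.{u} R} (hA : ExtVanish M A) (hB : ExtVanish M B) :
    ExtVanish M (ModuleCat.of R (A × B)) :=
  ExtVanish.middle_right (f := ModuleCat.ofHom (LinearMap.inl R A B))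
    (g := ModuleCat.ofHom (LinearMap.snd R A B)) LinearMap.inl_injective
    (Function.Exact.inl_snd) LinearMap.snd_surjective hA hB

variable {𝒲 𝒳 𝒴 𝒱 : ObjectProperty (ModuleCat.{u} R)} {M N : ModuleCat.{u} R}

/-! ### Comparison of resolutions -/

namespace ProperResolution

variable (X : ProperResolution 𝒳 M)

theorem exists_lift_aug {A : ModuleCat.{u} R} (hA : 𝒳 A) (φ : A ⟶ M) :
    ∃ ψ : A ⟶ X.complex.X 0, ψ ≫ X.aug = φ :=
  exists_lift_zero_of_homFrom_acyclic (X.proper A hA) φ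

theorem exists_lift_zero {A : ModuleCat.{u} R} (hA : 𝒳 A) (φ : A ⟶ X.complex.X 0)
    (hφ : φ ≫ X.aug = 0) : ∃ ψ : A ⟶ X.complex.X 1, ψ ≫ X.complex.d 1 0 = φ :=
  exists_lift_of_homFrom_acyclic (X.proper A hA) 0 φ hφ

theorem exists_lift_succ {A : ModuleCat.{u} R} (hA : 𝒳 A) (n : ℕ) (φ : A ⟶ X.complex.X (n + 1))
    (hφ : φ ≫ X.complex.d (n + 1) n = 0) :
    ∃ ψ : A ⟶ X.complex.X (n + 2), ψ ≫ X.complex.d (n + 2) (n + 1) = φ :=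
  exists_lift_of_homFrom_acyclic (X.proper A hA) (n + 1) φ hφ

end ProperResolution

theorem exists_liftsId (h : 𝒲 ≤ 𝒳) (W : ProperResolution 𝒲 M) (X : ProperResolution 𝒳 M) :
    ∃ f : W.complex ⟶ X.complex, LiftsId W X f := by
  have hW (n : ℕ) : 𝒳 (W.complex.X n) := h _ (W.mem n)
  obtain ⟨f₀, hf₀⟩ := X.exists_lift_aug (hW 0) W.aug
  obtain ⟨f₁, hf₁⟩ := X.exists_lift_zero (hW 1) (W.complex.d 1 0 ≫ f₀) (by
    rw [Category.assoc, hf₀, W.d_aug])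
  have hs (n : ℕ) (p : Σ' (f : W.complex.X n ⟶ X.complex.X n)
      (f' : W.complex.X (n + 1) ⟶ X.complex.X (n + 1)),
        f' ≫ X.complex.d (n + 1) n = W.complex.d (n + 1) n ≫ f) :
      ∃ f'' : W.complex.X (n + 2) ⟶ X.complex.X (n + 2),
        f'' ≫ X.complex.d (n + 2) (n + 1) = W.complex.d (n + 2) (n + 1) ≫ p.2.1 :=
    X.exists_lift_succ (hW _) n _ (by rw [Category.assoc, p.2.2]; simp)
  choose s hs using hs
  exact ⟨ChainComplex.mkHom _ _ f₀ f₁ hf₁ fun n p => ⟨s n p, hs n p⟩, hf₀⟩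

theorem LiftsId.nonempty_homotopy (h : 𝒲 ≤ 𝒳) {W : ProperResolution 𝒲 M}
    {X : ProperResolution 𝒳 M} {f f' : W.complex ⟶ X.complex} (hf : LiftsId W X f)
    (hf' : LiftsId W X f') : Nonempty (Homotopy f f') := by
  have hW (n : ℕ) : 𝒳 (W.complex.X n) := h _ (W.mem n)
  -- The difference lifts the zero map of `M`; properness of `X` then builds a null-homotopy degree
  -- by degree.
  let e := f - f'
  have he : e.f 0 ≫ X.aug = 0 := by
    simp only [e, HomologicalComplex.sub_f_apply, Preadditive.sub_comp]
    rw [hf, hf', sub_self]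
  obtain ⟨h₀, hh₀⟩ := X.exists_lift_zero (hW 0) (e.f 0) he
  obtain ⟨h₁, hh₁⟩ := X.exists_lift_succ (hW 1) 0 (e.f 1 - W.complex.d 1 0 ≫ h₀) (by
    rw [Preadditive.sub_comp, Category.assoc, hh₀, e.comm, sub_self])
  have hs (n : ℕ) (p : Σ' (k : W.complex.X n ⟶ X.complex.X (n + 1))
      (k' : W.complex.X (n + 1) ⟶ X.complex.X (n + 2)),
        e.f (n + 1) = W.complex.d (n + 1) n ≫ k + k' ≫ X.complex.d (n + 2) (n + 1)) :
      ∃ k'' : W.complex.X (n + 2) ⟶ X.complex.X (n + 3),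
        k'' ≫ X.complex.d (n + 3) (n + 2) =
          e.f (n + 2) - W.complex.d (n + 2) (n + 1) ≫ p.2.1 :=
    X.exists_lift_succ (hW _) (n + 1) _ (by
      have hp := congrArg (W.complex.d (n + 2) (n + 1) ≫ ·) p.2.2
      simp only [Preadditive.comp_add, HomologicalComplex.d_comp_d_assoc, zero_comp,
        zero_add] at hp
      rw [Preadditive.sub_comp, e.comm, Category.assoc, sub_eq_zero]
      exact hp)
  choose s hs using hs
  exact ⟨(Homotopy.equivSubZero).symm (Homotopy.mkInductive e h₀ hh₀.symm h₁
    (by rw [hh₁]; abel) fun n p => ⟨s n p, by rw [hs]; abel⟩)⟩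

theorem homologyMap_homToMap_eq_of_homotopy {ι : Type} {c : ComplexShape ι}
    {K L : HomologicalComplex (ModuleCat.{u} R) c} {f f' : K ⟶ L} (h : Homotopy f f')
    (N : ModuleCat.{u} R) (n : ι) :
    HomologicalComplex.homologyMap (homToMap f N) n =
      HomologicalComplex.homologyMap (homToMap f' N) n :=
  (((linearYoneda R (ModuleCat.{u} R)).obj N).mapHomotopy h.op).homologyMap_eq n

/-- The sequence `⋯ ⟶ W 1 ⟶ W 0 ⟶ 0`, with `W 0` in degree `1`. -/
def shiftSeq (W : ℕ → ModuleCat.{u} R) : ℕ → ModuleCat.{u} R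
  | 0 => ModuleCat.of R PUnit
  | n + 1 => W n

/-- The differentials of `shiftSeq W`. -/
def shiftSeqD {W : ℕ → ModuleCat.{u} R} (d : ∀ n, W (n + 1) ⟶ W n) :
    ∀ n, shiftSeq W (n + 1) ⟶ shiftSeq W n
  | 0 => 0
  | n + 1 => d n

/-- The differentials of the mapping cone of a morphism of sequences. -/
def coneSeqD {W X : ℕ → ModuleCat.{u} R} (dW : ∀ n, W (n + 1) ⟶ W n) (dX : ∀ n, X (n + 1) ⟶ X n)
    (f : ∀ n, W n ⟶ X n) (n : ℕ) :
    ModuleCat.of R (X (n + 1) × shiftSeq W (n + 1)) ⟶ ModuleCat.of R (X n × shiftSeq W n) :=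
  ModuleCat.ofHom (((dX n).hom.coprod (f n).hom).prod
    (-(shiftSeqD dW n).hom.comp (LinearMap.snd R _ _)))

/-- Both complexes resolve the same `M` and `f` lies over the identity, so the copies of `M` cancel
and the cone of the unaugmented complexes is exact down to degree `0`. -/
theorem coneSeq_isExactSeq (W : ProperResolution 𝒲 M) (X : ProperResolution 𝒳 M)
    {f : W.complex ⟶ X.complex} (hf : LiftsId W X f) :
    IsExactSeq (fun n => ModuleCat.of R (X.complex.X n × shiftSeq W.complex.X n))
      (coneSeqD (fun n => W.complex.d (n + 1) n) (fun n => X.complex.d (n + 1) n) f.f) := by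
  have hW := isExactSeq_of_acyclic W.exact
  have hX := isExactSeq_of_acyclic X.exact
  have hf' (w : W.complex.X 0) : X.aug (f.f 0 w) = W.aug w :=
    congrArg (fun t : W.complex.X 0 ⟶ M => t.hom w) hf
  have hfd (n : ℕ) (w : W.complex.X (n + 1)) :
      X.complex.d (n + 1) n (f.f (n + 1) w) = f.f n (W.complex.d (n + 1) n w) :=
    congrArg (fun t : W.complex.X (n + 1) ⟶ X.complex.X n => t.hom w) (f.comm (n + 1) n)
  have hX0 (x : X.complex.X 0) : X.aug x = 0 ↔ ∃ y, X.complex.d 1 0 y = x := hX.exact 0 x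
  have hW0 (x : W.complex.X 0) : W.aug x = 0 ↔ ∃ y, W.complex.d 1 0 y = x := hW.exact 0 x
  have hXn (n : ℕ) (x : X.complex.X (n + 1)) :
      X.complex.d (n + 1) n x = 0 ↔ ∃ y, X.complex.d (n + 2) (n + 1) y = x := hX.exact (n + 1) x
  have hWn (n : ℕ) (x : W.complex.X (n + 1)) :
      W.complex.d (n + 1) n x = 0 ↔ ∃ y, W.complex.d (n + 2) (n + 1) y = x := hW.exact (n + 1) x
  have hdd (n : ℕ) (x : X.complex.X (n + 2)) :
      X.complex.d (n + 1) n (X.complex.d (n + 2) (n + 1) x) = 0 := (hXn _ _).2 ⟨x, rfl⟩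
  have key (n : ℕ) (x : X.complex.X (n + 1)) (w' : W.complex.X (n + 1))
      (h : X.complex.d (n + 1) n x + f.f n (W.complex.d (n + 1) n w') = 0) :
      ∃ y : X.complex.X (n + 2), X.complex.d (n + 2) (n + 1) y + f.f (n + 1) (-w') = x := by
    obtain ⟨y, hy⟩ := (hXn n (x + f.f (n + 1) w')).1 (by rw [map_add, hfd, h])
    exact ⟨y, by rw [hy, map_neg]; abel⟩
  refine ⟨?_, fun n => exact_of_comp_eq_zero ?_ ?_⟩
  · rintro ⟨x, ⟨⟩⟩
    -- With `w` over the same element of `M` as `x`, the difference `x - f w` is a boundary.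
    obtain ⟨w, hw⟩ : ∃ w : W.complex.X 0, W.aug w = X.aug x := hW.surjective (X.aug x)
    obtain ⟨y, hy⟩ := (hX0 (x - f.f 0 w)).1 (by rw [map_sub, hf', hw, sub_self])
    refine ⟨(y, w), Prod.ext ?_ rfl⟩
    change X.complex.d 1 0 y + f.f 0 w = x
    rw [hy]; abel
  · refine ModuleCat.hom_ext (LinearMap.ext fun ⟨x, (w : W.complex.X (n + 1))⟩ => ?_)
    refine Prod.ext ?_ ?_
    · change X.complex.d (n + 1) n (X.complex.d (n + 2) (n + 1) x + f.f (n + 1) w) +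
        f.f n (-(W.complex.d (n + 1) n w)) = 0
      rw [map_add, hdd, hfd, map_neg]; abel
    · cases n with
      | zero => rfl
      | succ n =>
        change -(W.complex.d (n + 1) n (-(W.complex.d (n + 2) (n + 1) w))) = 0
        rw [map_neg, (hWn _ _).2 ⟨w, rfl⟩]; simp
  · rintro ⟨x, (w : W.complex.X n)⟩ h
    have h₁ : X.complex.d (n + 1) n x + f.f n w = 0 := congrArg Prod.fst h
    have h₂ : -(shiftSeqD (fun n => W.complex.d (n + 1) n) n w) = 0 := congrArg Prod.snd h
    obtain ⟨w', rfl⟩ : ∃ w' : W.complex.X (n + 1), W.complex.d (n + 1) n w' = w := by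
      cases n with
      | zero =>
        -- In this degree the second component of the cone is trivial, so `w` is recognised as a
        -- boundary by its image in `M`, computed through `X` from the first component.
        refine (hW0 w).1 ?_
        rw [← hf', ← neg_eq_of_add_eq_zero_right h₁, map_neg, (hX0 _).2 ⟨x, rfl⟩, neg_zero]
      | succ n => exact (hWn n w).1 (neg_eq_zero.1 h₂)
    obtain ⟨y, hy⟩ := key n x w' h₁
    refine ⟨(y, -w'), Prod.ext hy ?_⟩
    change -(W.complex.d (n + 1) n (-w')) = _
    rw [map_neg, neg_neg]

/-- Maps from the cone to `N` are pairs of maps on `X` and on the shift of `W`. Extending suitable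
cocycle pairs over the next lower degree gives both injectivity and surjectivity on cohomology. -/
theorem isIso_homologyMap_homToMap (W : ProperResolution 𝒲 M) (X : ProperResolution 𝒳 M)
    {f : W.complex ⟶ X.complex} (hf : LiftsId W X f) (hW : ∀ n, ExtVanish (W.complex.X n) N)
    (hX : ∀ n, ExtVanish (X.complex.X n) N) (n : ℕ) :
    IsIso (HomologicalComplex.homologyMap (homToMap f N) n) := by
  have hcone := coneSeq_isExactSeq W X hf
  have hshift : ∀ n, ExtVanish (shiftSeq W.complex.X n) N
    | 0 => ExtVanish.of_isZero_left (ModuleCat.isZero_of_subsingleton (ModuleCat.of R PUnit))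
    | n + 1 => hW n
  have hhom := hcone.homToExactSeq (N := N) fun n => (hX n).prod_left (hshift n)
  -- For surjectivity, the pair `(0, y)` is a cocycle on the cone; the `X`-component of `ψ` is a
  -- cocycle whose pullback along `f` is cohomologous to `y`.
  have hsurj (y : W.complex.X n ⟶ N) (hy : W.complex.d (n + 1) n ≫ y = 0) :
      ∃ ψ : ModuleCat.of R (X.complex.X n × shiftSeq W.complex.X n) ⟶ N,
        coneSeqD (fun n => W.complex.d (n + 1) n) (fun n => X.complex.d (n + 1) n) f.f n ≫ ψ =
          ModuleCat.ofHom (y.hom.comp (LinearMap.snd R (X.complex.X (n + 1)) (W.complex.X n))) := by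
    refine hhom n _ ?_
    refine ModuleCat.hom_ext (LinearMap.ext fun ⟨x, (w : W.complex.X (n + 1))⟩ => ?_)
    change y (-(W.complex.d (n + 1) n w)) = 0
    rw [map_neg, ← ModuleCat.comp_apply, hy, neg_eq_zero]
    rfl
  cases n with
  | zero =>
    -- In degree `0` there are no nonzero coboundaries, so injectivity asks for `α = 0`. This holds
    -- because `X 0` is spanned by the images of `d 1 0` and `f`, both killed by `α`.
    refine isIso_homologyMap _ (i := 0) (k := 1) next_down_zero (prev_down 0) ?_ ?_
    · intro (α : X.complex.X 0 ⟶ N) (hα : X.complex.d 1 0 ≫ α = 0) (y : W.complex.X 0 ⟶ N)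
        (hy : f.f 0 ≫ α = W.complex.d 0 0 ≫ y)
      refine ⟨(0 : X.complex.X 0 ⟶ N), ?_⟩
      change X.complex.d 0 0 ≫ (0 : X.complex.X 0 ⟶ N) = α
      ext x
      obtain ⟨⟨x', (w : W.complex.X 0)⟩, hxw⟩ := hcone.surjective (x, PUnit.unit)
      obtain rfl : X.complex.d 1 0 x' + f.f 0 w = x := congrArg Prod.fst hxw
      have h₁ : α (X.complex.d 1 0 x') = 0 := by
        rw [← ModuleCat.comp_apply, hα]; rfl
      have h₂ : α (f.f 0 w) = 0 := by
        rw [← ModuleCat.comp_apply, hy]; simp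
      rw [comp_zero]
      change 0 = α (X.complex.d 1 0 x' + f.f 0 w)
      rw [map_add, h₁, h₂, add_zero]
    · intro (y : W.complex.X 0 ⟶ N) (hy : W.complex.d 1 0 ≫ y = 0)
      obtain ⟨ψ, hψ⟩ := hsurj y hy
      have hψ' (x : X.complex.X 1) (w : W.complex.X 0) :
          ψ ((X.complex.d 1 0 x + f.f 0 w, -0) : X.complex.X 0 × shiftSeq W.complex.X 0) = y w :=
        congrArg (fun t => t.hom (x, w)) hψ
      refine ⟨ModuleCat.ofHom (ψ.hom.comp (LinearMap.inl R _ _)), ?_, (0 : W.complex.X 0 ⟶ N), ?_⟩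
      · change X.complex.d 1 0 ≫ ModuleCat.ofHom (ψ.hom.comp (LinearMap.inl R _ _)) = 0
        ext x
        simpa using hψ' x 0
      · change W.complex.d 0 0 ≫ (0 : W.complex.X 0 ⟶ N) =
          f.f 0 ≫ ModuleCat.ofHom (ψ.hom.comp (LinearMap.inl R _ _)) - y
        ext w
        have := hψ' 0 w
        simp only [map_zero, zero_add, neg_zero] at this
        rw [comp_zero]
        refine (sub_eq_zero.2 ?_).symm
        exact this
  | succ n =>
    refine isIso_homologyMap _ (i := n) (k := n + 2) (next_down n) (prev_down _) ?_ ?_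
    · intro (α : X.complex.X (n + 1) ⟶ N) (hα : X.complex.d (n + 2) (n + 1) ≫ α = 0)
        (y : W.complex.X n ⟶ N) (hy : f.f (n + 1) ≫ α = W.complex.d (n + 1) n ≫ y)
      -- For injectivity, the relation `f ≫ α = d ≫ y` makes `(α, y)` a cocycle on the cone; the
      -- `X`-component of `ψ` bounds `α`.
      obtain ⟨ψ, hψ⟩ := hhom n (ModuleCat.ofHom (α.hom.coprod y.hom)) (by
        refine ModuleCat.hom_ext (LinearMap.ext fun ⟨x, (w : W.complex.X (n + 1))⟩ => ?_)
        change α (X.complex.d (n + 2) (n + 1) x + f.f (n + 1) w) +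
          y (-(W.complex.d (n + 1) n w)) = 0
        rw [map_add, map_neg, ← ModuleCat.comp_apply, ← ModuleCat.comp_apply,
          ← ModuleCat.comp_apply, hα, hy]
        simp)
      refine ⟨ModuleCat.ofHom (ψ.hom.comp (LinearMap.inl R _ _)), ?_⟩
      change X.complex.d (n + 1) n ≫ ModuleCat.ofHom (ψ.hom.comp (LinearMap.inl R _ _)) = α
      ext x
      have : ψ ((X.complex.d (n + 1) n x + f.f n 0,
          -(shiftSeqD (fun n => W.complex.d (n + 1) n) n 0)) :
            X.complex.X n × shiftSeq W.complex.X n) = α x + y 0 :=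
        congrArg (fun t => t.hom (x, 0)) hψ
      simpa using this
    · intro (y : W.complex.X (n + 1) ⟶ N) (hy : W.complex.d (n + 2) (n + 1) ≫ y = 0)
      obtain ⟨ψ, hψ⟩ := hsurj y hy
      have hψ' (x : X.complex.X (n + 2)) (w : W.complex.X (n + 1)) :
          ψ ((X.complex.d (n + 2) (n + 1) x + f.f (n + 1) w, -(W.complex.d (n + 1) n w)) :
            X.complex.X (n + 1) × W.complex.X n) = y w :=
        congrArg (fun t => t.hom (x, w)) hψ
      refine ⟨ModuleCat.ofHom (ψ.hom.comp (LinearMap.inl R _ _)), ?_,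
        ModuleCat.ofHom (ψ.hom.comp (LinearMap.inr R (X.complex.X (n + 1)) (W.complex.X n))), ?_⟩
      · change X.complex.d _ _ ≫ ModuleCat.ofHom (ψ.hom.comp (LinearMap.inl R _ _)) = 0
        ext x
        have := hψ' x 0
        simp only [map_zero, add_zero, neg_zero] at this
        exact this
      · change W.complex.d (n + 1) n ≫
            ModuleCat.ofHom (ψ.hom.comp (LinearMap.inr R (X.complex.X (n + 1)) (W.complex.X n))) =
          f.f (n + 1) ≫ ModuleCat.ofHom (ψ.hom.comp
            (LinearMap.inl R (X.complex.X (n + 1)) (W.complex.X n))) - y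
        ext w
        change ψ ((0, W.complex.d (n + 1) n w) : X.complex.X (n + 1) × W.complex.X n) =
          ψ ((f.f (n + 1) w, 0) : X.complex.X (n + 1) × W.complex.X n) - y w
        rw [← hψ' 0 w]
        refine eq_sub_of_add_eq ((map_add ψ.hom _ _).symm.trans (congrArg ψ.hom ?_))
        refine Prod.ext ?_ (add_neg_cancel (W.complex.d (n + 1) n w))
        change 0 + (X.complex.d (n + 2) (n + 1) 0 + f.f (n + 1) w) = f.f (n + 1) w
        rw [map_zero, zero_add, zero_add]

theorem exists_isTheta_isIso (h : 𝒲 ≤ 𝒳) (hN : ∀ X, 𝒳 X → ExtVanish X N)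
    (X : ProperResolution 𝒳 M) (W : ProperResolution 𝒲 M) (n : ℕ) :
    ∃ θ : extLeft X N n ⟶ extLeft W N n, IsTheta X W N n θ ∧ IsIso θ := by
  obtain ⟨f, hf⟩ := exists_liftsId h W X
  refine ⟨HomologicalComplex.homologyMap (homToMap f N) n, ⟨⟨f, hf⟩, fun f' hf' => ?_⟩,
    isIso_homologyMap_homToMap W X hf (fun n => hN _ (h _ (W.mem n))) (fun n => hN _ (X.mem n)) n⟩
  obtain ⟨k⟩ := hf.nonempty_homotopy h hf'
  exact homologyMap_homToMap_eq_of_homotopy k N n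

end Comparison

section CoComparison

variable {𝒲 𝒳 𝒴 𝒱 : ObjectProperty (ModuleCat.{u} R)} {M N : ModuleCat.{u} R}

/-! ### Comparison of coresolutions -/

namespace ProperCoresolution

variable (Y : ProperCoresolution 𝒴 N)

theorem exists_extend_coaug {A : ModuleCat.{u} R} (hA : 𝒴 A) (φ : N ⟶ A) :
    ∃ ψ : Y.complex.X 0 ⟶ A, Y.coaug ≫ ψ = φ :=
  exists_extend_zero_of_homTo_acyclic (Y.proper A hA) φ

theorem exists_extend_zero {A : ModuleCat.{u} R} (hA : 𝒴 A) (φ : Y.complex.X 0 ⟶ A)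
    (hφ : Y.coaug ≫ φ = 0) : ∃ ψ : Y.complex.X 1 ⟶ A, Y.complex.d 0 1 ≫ ψ = φ :=
  exists_extend_of_homTo_acyclic (Y.proper A hA) 0 φ hφ

theorem exists_extend_succ {A : ModuleCat.{u} R} (hA : 𝒴 A) (n : ℕ) (φ : Y.complex.X (n + 1) ⟶ A)
    (hφ : Y.complex.d n (n + 1) ≫ φ = 0) :
    ∃ ψ : Y.complex.X (n + 2) ⟶ A, Y.complex.d (n + 1) (n + 2) ≫ ψ = φ :=
  exists_extend_of_homTo_acyclic (Y.proper A hA) (n + 1) φ hφ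

end ProperCoresolution

theorem exists_extendsId (h : 𝒱 ≤ 𝒴) (Y : ProperCoresolution 𝒴 N) (V : ProperCoresolution 𝒱 N) :
    ∃ f : Y.complex ⟶ V.complex, ExtendsId Y V f := by
  have hV (n : ℕ) : 𝒴 (V.complex.X n) := h _ (V.mem n)
  obtain ⟨f₀, hf₀⟩ := Y.exists_extend_coaug (hV 0) V.coaug
  obtain ⟨f₁, hf₁⟩ := Y.exists_extend_zero (hV 1) (f₀ ≫ V.complex.d 0 1) (by
    rw [← Category.assoc, hf₀, V.coaug_d])
  have hs (n : ℕ) (p : Σ' (f : Y.complex.X n ⟶ V.complex.X n)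
      (f' : Y.complex.X (n + 1) ⟶ V.complex.X (n + 1)),
        f ≫ V.complex.d n (n + 1) = Y.complex.d n (n + 1) ≫ f') :
      ∃ f'' : Y.complex.X (n + 2) ⟶ V.complex.X (n + 2),
        Y.complex.d (n + 1) (n + 2) ≫ f'' = p.2.1 ≫ V.complex.d (n + 1) (n + 2) :=
    Y.exists_extend_succ (hV _) n _ (by rw [← Category.assoc, ← p.2.2]; simp)
  choose s hs using hs
  exact ⟨CochainComplex.mkHom _ _ f₀ f₁ hf₁.symm fun n p => ⟨s n p, (hs n p).symm⟩, hf₀⟩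

theorem ExtendsId.nonempty_homotopy (h : 𝒱 ≤ 𝒴) {Y : ProperCoresolution 𝒴 N}
    {V : ProperCoresolution 𝒱 N} {f f' : Y.complex ⟶ V.complex} (hf : ExtendsId Y V f)
    (hf' : ExtendsId Y V f') : Nonempty (Homotopy f f') := by
  have hV (n : ℕ) : 𝒴 (V.complex.X n) := h _ (V.mem n)
  let e := f - f'
  have he : Y.coaug ≫ e.f 0 = 0 := by
    simp only [e, HomologicalComplex.sub_f_apply, Preadditive.comp_sub]
    rw [hf, hf', sub_self]
  obtain ⟨h₀, hh₀⟩ := Y.exists_extend_zero (hV 0) (e.f 0) he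
  obtain ⟨h₁, hh₁⟩ := Y.exists_extend_succ (hV 1) 0 (e.f 1 - h₀ ≫ V.complex.d 0 1) (by
    rw [Preadditive.comp_sub, ← Category.assoc, hh₀, e.comm, sub_self])
  have hs (n : ℕ) (p : Σ' (k : Y.complex.X (n + 1) ⟶ V.complex.X n)
      (k' : Y.complex.X (n + 2) ⟶ V.complex.X (n + 1)),
        e.f (n + 1) = k ≫ V.complex.d n (n + 1) + Y.complex.d (n + 1) (n + 2) ≫ k') :
      ∃ k'' : Y.complex.X (n + 3) ⟶ V.complex.X (n + 2),
        Y.complex.d (n + 2) (n + 3) ≫ k'' =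
          e.f (n + 2) - p.2.1 ≫ V.complex.d (n + 1) (n + 2) :=
    Y.exists_extend_succ (hV _) (n + 1) _ (by
      have hp := congrArg (· ≫ V.complex.d (n + 1) (n + 2)) p.2.2
      simp only [Preadditive.add_comp, Category.assoc, HomologicalComplex.d_comp_d, comp_zero,
        zero_add] at hp
      rw [Preadditive.comp_sub, ← e.comm, sub_eq_zero]
      exact hp)
  choose s hs using hs
  exact ⟨(Homotopy.equivSubZero).symm (Homotopy.mkCoinductive e h₀ hh₀.symm h₁
    (by rw [hh₁]; abel) fun n p => ⟨s n p, by rw [hs]; abel⟩)⟩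

theorem homologyMap_homFromMap_eq_of_homotopy {ι : Type} {c : ComplexShape ι}
    {K L : HomologicalComplex (ModuleCat.{u} R) c} {f f' : K ⟶ L} (h : Homotopy f f')
    (M : ModuleCat.{u} R) (n : ι) :
    HomologicalComplex.homologyMap (homFromMap M f) n =
      HomologicalComplex.homologyMap (homFromMap M f') n :=
  (((linearCoyoneda R (ModuleCat.{u} R)).obj (op M)).mapHomotopy h).homologyMap_eq n

/-- The differentials of the cochain sequence `0 ⟶ V 0 ⟶ V 1 ⟶ ⋯` with `V 0` in degree `1`. -/
def shiftCoseqD {V : ℕ → ModuleCat.{u} R} (d : ∀ n, V n ⟶ V (n + 1)) :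
    ∀ n, shiftSeq V n ⟶ shiftSeq V (n + 1)
  | 0 => 0
  | n + 1 => d n

/-- The differentials of the (shifted) mapping cone of a morphism of cochain sequences. -/
def coneCoseqD {Y V : ℕ → ModuleCat.{u} R} (dY : ∀ n, Y n ⟶ Y (n + 1)) (dV : ∀ n, V n ⟶ V (n + 1))
    (f : ∀ n, Y n ⟶ V n) (n : ℕ) :
    ModuleCat.of R (Y n × shiftSeq V n) ⟶ ModuleCat.of R (Y (n + 1) × shiftSeq V (n + 1)) :=
  ModuleCat.ofHom (((dY n).hom.comp (LinearMap.fst R _ _)).prod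
    ((f n).hom.coprod (-(shiftCoseqD dV n).hom)))

/-- As for resolutions, the two copies of `N` cancel because `f` extends the identity. -/
theorem coneCoseq_isExactCoseq (Y : ProperCoresolution 𝒴 N) (V : ProperCoresolution 𝒱 N)
    {f : Y.complex ⟶ V.complex} (hf : ExtendsId Y V f) :
    IsExactCoseq (fun n => ModuleCat.of R (Y.complex.X n × shiftSeq V.complex.X n))
      (coneCoseqD (fun n => Y.complex.d n (n + 1)) (fun n => V.complex.d n (n + 1)) f.f) := by
  have hY := isExactCoseq_of_acyclic Y.exact
  have hV := isExactCoseq_of_acyclic V.exact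
  have hf' (x : N) : f.f 0 (Y.coaug x) = V.coaug x :=
    congrArg (fun t : N ⟶ V.complex.X 0 => t.hom x) hf
  have hfd (n : ℕ) (y : Y.complex.X n) :
      V.complex.d n (n + 1) (f.f n y) = f.f (n + 1) (Y.complex.d n (n + 1) y) :=
    congrArg (fun t : Y.complex.X n ⟶ V.complex.X (n + 1) => t.hom y) (f.comm n (n + 1))
  have hY0 (y : Y.complex.X 0) : Y.complex.d 0 1 y = 0 ↔ ∃ x, Y.coaug x = y := hY.exact 0 y
  have hV0 (v : V.complex.X 0) : V.complex.d 0 1 v = 0 ↔ ∃ x, V.coaug x = v := hV.exact 0 v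
  have hYn (n : ℕ) (y : Y.complex.X (n + 1)) :
      Y.complex.d (n + 1) (n + 2) y = 0 ↔ ∃ x, Y.complex.d n (n + 1) x = y := hY.exact (n + 1) y
  have hVn (n : ℕ) (v : V.complex.X (n + 1)) :
      V.complex.d (n + 1) (n + 2) v = 0 ↔ ∃ x, V.complex.d n (n + 1) x = v := hV.exact (n + 1) v
  have hinj (x : N) (hx : V.coaug x = 0) : x = 0 :=
    (injective_iff_map_eq_zero (V.coaug.hom)).1 hV.injective x hx
  refine ⟨?_, fun n => exact_of_comp_eq_zero ?_ ?_⟩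
  · rw [injective_iff_map_eq_zero]
    rintro ⟨y, ⟨⟩⟩ h
    have h₁ : Y.complex.d 0 1 y = 0 := congrArg Prod.fst h
    have h₂ : f.f 0 y + (-0 : V.complex.X 0) = 0 := congrArg Prod.snd h
    obtain ⟨x, rfl⟩ := (hY0 y).1 h₁
    rw [hf', neg_zero, add_zero] at h₂
    rw [hinj x h₂, map_zero]
    rfl
  · refine ModuleCat.hom_ext (LinearMap.ext fun ⟨y, v⟩ => ?_)
    refine Prod.ext ((hYn n _).2 ⟨y, rfl⟩) ?_
    change f.f (n + 1) (Y.complex.d n (n + 1) y) + -(V.complex.d n (n + 1)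
      (f.f n y + -(show V.complex.X n from shiftCoseqD (fun n => V.complex.d n (n + 1)) n v))) = 0
    rw [map_add, hfd, map_neg]
    have : V.complex.d n (n + 1) (shiftCoseqD (fun n => V.complex.d n (n + 1)) n v) = 0 := by
      cases n with
      | zero => exact map_zero _
      | succ n => exact (hVn n _).2 ⟨v, rfl⟩
    rw [this]; simp
  · rintro ⟨y, (v : V.complex.X n)⟩ h
    have h₁ : Y.complex.d (n + 1) (n + 2) y = 0 := congrArg Prod.fst h
    have h₂ : f.f (n + 1) y + -(V.complex.d n (n + 1) v) = 0 := congrArg Prod.snd h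
    obtain ⟨y, rfl⟩ := (hYn n y).1 h₁
    have h₃ : V.complex.d n (n + 1) (f.f n y - v) = 0 := by
      rw [map_sub, hfd, sub_eq_add_neg, h₂]
    cases n with
    | zero =>
      obtain ⟨x, hx⟩ := (hV0 _).1 h₃
      -- No `V`-component is available in degree `0`, so the discrepancy between `f y` and `v`,
      -- which comes from `x` in `N`, is absorbed by correcting `y`.
      refine ⟨(y - Y.coaug x, PUnit.unit), Prod.ext ?_ ?_⟩
      · change Y.complex.d 0 1 (y - Y.coaug x) = Y.complex.d 0 1 y
        rw [map_sub, (hY0 _).2 ⟨x, rfl⟩, sub_zero]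
      · change f.f 0 (y - Y.coaug x) + (-0 : V.complex.X 0) = v
        rw [map_sub, hf', hx]; simp
    | succ n =>
      obtain ⟨w, hw⟩ := (hVn n _).1 h₃
      refine ⟨(y, w), Prod.ext rfl ?_⟩
      change f.f (n + 1) y + -(V.complex.d n (n + 1) w) = v
      rw [hw]; abel

theorem isIso_homologyMap_homFromMap (Y : ProperCoresolution 𝒴 N) (V : ProperCoresolution 𝒱 N)
    {f : Y.complex ⟶ V.complex} (hf : ExtendsId Y V f) (hY : ∀ n, ExtVanish M (Y.complex.X n))
    (hV : ∀ n, ExtVanish M (V.complex.X n)) (n : ℕ) :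
    IsIso (HomologicalComplex.homologyMap (homFromMap M f) n) := by
  have hcone := coneCoseq_isExactCoseq Y V hf
  have hshift : ∀ n, ExtVanish M (shiftSeq V.complex.X n)
    | 0 => ExtVanish.of_isZero_right (ModuleCat.isZero_of_subsingleton (ModuleCat.of R PUnit))
    | n + 1 => hV n
  have hhom := hcone.homFromExactCoseq (M := M) fun n => (hY n).prod_right (hshift n)
  -- The pair `(0, y)` is a cocycle on the cone; the two components of a lift supply the cocycle `x`
  -- and the coboundary comparing its image with `y`.
  have hsurj (y : M ⟶ V.complex.X n) (hy : y ≫ V.complex.d n (n + 1) = 0) :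
      ∃ (x : M ⟶ Y.complex.X n) (z : M ⟶ shiftSeq V.complex.X n), x ≫ Y.complex.d n (n + 1) = 0 ∧
        z ≫ shiftCoseqD (fun n => V.complex.d n (n + 1)) n = x ≫ f.f n - y := by
    obtain ⟨ψ, hψ⟩ := hhom n
      (ModuleCat.ofHom ((LinearMap.inr R (Y.complex.X (n + 1)) (V.complex.X n)).comp y.hom)) (by
        refine ModuleCat.hom_ext (LinearMap.ext fun m =>
          Prod.ext (map_zero (Y.complex.d (n + 1) (n + 2)).hom) ?_)
        change f.f (n + 1) 0 + -(V.complex.d n (n + 1) (y m)) = 0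
        rw [map_zero, ← ModuleCat.comp_apply, hy, zero_add, neg_eq_zero]
        rfl)
    have hψ' (m : M) := congrArg (fun t => t.hom m) hψ
    refine ⟨ψ ≫ ModuleCat.ofHom (LinearMap.fst R _ _),
      ψ ≫ ModuleCat.ofHom (LinearMap.snd R (Y.complex.X n) (shiftSeq V.complex.X n)),
      ModuleCat.hom_ext (LinearMap.ext fun m => congrArg Prod.fst (hψ' m)),
      ModuleCat.hom_ext (LinearMap.ext fun m => ?_)⟩
    have := congrArg Prod.snd (hψ' m)
    change f.f n (ψ m).1 + -(show V.complex.X n from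
      shiftCoseqD (fun n => V.complex.d n (n + 1)) n (ψ m).2) = y m at this
    change (show V.complex.X n from shiftCoseqD (fun n => V.complex.d n (n + 1)) n (ψ m).2) =
      f.f n (ψ m).1 - y m
    rw [← this]; abel
  cases n with
  | zero =>
    refine isIso_homologyMap _ (i := 0) (k := 1) prev_up_zero (next_up 0) ?_ ?_
    · intro (α : M ⟶ Y.complex.X 0) (hα : α ≫ Y.complex.d 0 1 = 0) (y : M ⟶ V.complex.X 0)
        (hy : α ≫ f.f 0 = y ≫ V.complex.d 0 0)
      refine ⟨(0 : M ⟶ Y.complex.X 0), ?_⟩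
      change (0 : M ⟶ Y.complex.X 0) ≫ Y.complex.d 0 0 = α
      ext m
      have h₁ : Y.complex.d 0 1 (α m) = 0 := by
        rw [← ModuleCat.comp_apply, hα]; rfl
      have h₂ : f.f 0 (α m) + (-0 : V.complex.X 0) = 0 := by
        rw [← ModuleCat.comp_apply, hy]; simp
      have := (injective_iff_map_eq_zero _).1 hcone.injective (α m, PUnit.unit) (Prod.ext h₁ h₂)
      rw [zero_comp]
      exact (congrArg Prod.fst this).symm
    · intro (y : M ⟶ V.complex.X 0) (hy : y ≫ V.complex.d 0 1 = 0)
      obtain ⟨x, z, hx, hz⟩ := hsurj y hy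
      refine ⟨x, hx, (0 : M ⟶ V.complex.X 0), ?_⟩
      change (0 : M ⟶ V.complex.X 0) ≫ V.complex.d 0 0 = x ≫ f.f 0 - y
      rw [zero_comp, ← hz]
      exact comp_zero.symm
  | succ n =>
    refine isIso_homologyMap _ (i := n) (k := n + 2) (prev_up n) (next_up _) ?_ ?_
    · intro (α : M ⟶ Y.complex.X (n + 1)) (hα : α ≫ Y.complex.d (n + 1) (n + 2) = 0)
        (y : M ⟶ V.complex.X n) (hy : α ≫ f.f (n + 1) = y ≫ V.complex.d n (n + 1))
      obtain ⟨ψ, hψ⟩ := hhom n (ModuleCat.ofHom (α.hom.prod y.hom)) (by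
        refine ModuleCat.hom_ext (LinearMap.ext fun m => Prod.ext ?_ ?_)
        · exact congrArg (fun t => t.hom m) hα
        · change f.f (n + 1) (α m) + -(V.complex.d n (n + 1) (y m)) = 0
          rw [← ModuleCat.comp_apply, ← ModuleCat.comp_apply, hy, add_neg_cancel])
      exact ⟨ψ ≫ ModuleCat.ofHom (LinearMap.fst R _ _), ModuleCat.hom_ext (LinearMap.ext fun m =>
        congrArg Prod.fst (congrArg (fun t => t.hom m) hψ))⟩
    · intro (y : M ⟶ V.complex.X (n + 1)) (hy : y ≫ V.complex.d (n + 1) (n + 2) = 0)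
      obtain ⟨x, z, hx, hz⟩ := hsurj y hy
      exact ⟨x, hx, z, hz⟩

theorem exists_isCotheta_isIso (h : 𝒱 ≤ 𝒴) (hM : ∀ Y, 𝒴 Y → ExtVanish M Y)
    (Y : ProperCoresolution 𝒴 N) (V : ProperCoresolution 𝒱 N) (n : ℕ) :
    ∃ θ : extRight M Y n ⟶ extRight M V n, IsCotheta M Y V n θ ∧ IsIso θ := by
  obtain ⟨f, hf⟩ := exists_extendsId h Y V
  refine ⟨HomologicalComplex.homologyMap (homFromMap M f) n, ⟨⟨f, hf⟩, fun f' hf' => ?_⟩,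
    isIso_homologyMap_homFromMap Y V hf (fun n => hM _ (Y.mem n)) (fun n => hM _ (h _ (V.mem n))) n⟩
  obtain ⟨k⟩ := hf.nonempty_homotopy h hf'
  exact homologyMap_homFromMap_eq_of_homotopy k M n

end CoComparison

section HomTensor

open TensorProduct

/-! ### Homomorphisms into injective and out of projective modules -/

theorem exists_comp_eq_of_injective {A B D I : Type u} [AddCommGroup A] [Module R A]
    [AddCommGroup B] [Module R B] [AddCommGroup D] [Module R D] [AddCommGroup I] [Module R I]
    [Module.Injective R I] {f : A →ₗ[R] B} {g : B →ₗ[R] D} (h : Function.Exact f g)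
    (φ : B →ₗ[R] I) (hφ : φ ∘ₗ f = 0) : ∃ ψ : D →ₗ[R] I, ψ ∘ₗ g = φ := by
  have hker : LinearMap.ker g ≤ LinearMap.ker φ := by
    intro x hx
    obtain ⟨y, rfl⟩ := (h x).1 hx
    exact LinearMap.congr_fun hφ y
  obtain ⟨ψ, hψ⟩ := Module.Injective.out ((LinearMap.ker g).liftQ g le_rfl)
    (LinearMap.ker_eq_bot.1 (Submodule.ker_liftQ_eq_bot _ _ _ le_rfl))
    ((LinearMap.ker g).liftQ φ hker)
  exact ⟨ψ, LinearMap.ext fun x => hψ (Submodule.Quotient.mk x)⟩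

theorem exists_comp_eq_of_projective {A B D P : Type u} [AddCommGroup A] [Module R A]
    [AddCommGroup B] [Module R B] [AddCommGroup D] [Module R D] [AddCommGroup P] [Module R P]
    [Module.Projective R P] {f : A →ₗ[R] B} {g : B →ₗ[R] D} (h : Function.Exact f g)
    (φ : P →ₗ[R] B) (hφ : g ∘ₗ φ = 0) : ∃ ψ : P →ₗ[R] A, f ∘ₗ ψ = φ := by
  obtain ⟨ψ, hψ⟩ := Module.projective_lifting_property f.rangeRestrict
    (φ.codRestrict (LinearMap.range f) fun x => (h _).1 (LinearMap.congr_fun hφ x))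
    f.surjective_rangeRestrict
  exact ⟨ψ, LinearMap.ext fun x => congrArg Subtype.val (LinearMap.congr_fun hψ x)⟩

/-- By adjunction `Hom(-, Hom(F, I))` is `Hom(- ⊗ F, I)`, a composite of exact functors. -/
theorem injective_linearMap_of_flat (F I : Type u) [AddCommGroup F] [Module R F]
    [AddCommGroup I] [Module R I] [Module.Flat R F] [Module.Injective R I] :
    Module.Injective R (F →ₗ[R] I) where
  out X Y _ _ _ _ f hf g := by
    obtain ⟨h, hh⟩ := Module.Injective.out (f.rTensor F)
      (Module.Flat.rTensor_preserves_injective_linearMap f hf) (TensorProduct.lift g)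
    refine ⟨TensorProduct.curry h, fun x => LinearMap.ext fun y => ?_⟩
    simpa using hh (x ⊗ₜ y)

/-! ### The tensor evaluation morphism -/

section TensorEval

variable (R) (C I F : Type u) [AddCommGroup C] [Module R C] [AddCommGroup I] [Module R I]
  [AddCommGroup F] [Module R F]

/-- The tensor evaluation morphism `Hom(C, I) ⊗ F → Hom(Hom(F, C), I)`. -/
noncomputable def tensorEval : (C →ₗ[R] I) ⊗[R] F →ₗ[R] (F →ₗ[R] C) →ₗ[R] I :=
  TensorProduct.lift (LinearMap.mk₂ R (fun j x => j ∘ₗ LinearMap.applyₗ x)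
    (fun _ _ _ => rfl) (fun _ _ _ => rfl)
    (fun j x y => by ext g; simp) (fun a j x => by ext g; simp))

variable {R C I F}

@[simp]
theorem tensorEval_tmul (j : C →ₗ[R] I) (x : F) (g : F →ₗ[R] C) :
    tensorEval R C I F (j ⊗ₜ x) g = j (g x) := rfl

theorem tensorEval_lTensor {F' : Type u} [AddCommGroup F'] [Module R F'] (d : F →ₗ[R] F')
    (t : (C →ₗ[R] I) ⊗[R] F) :
    tensorEval R C I F' (d.lTensor _ t) = tensorEval R C I F t ∘ₗ LinearMap.lcomp R C d := by
  induction t with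
  | zero => simp
  | add x y hx hy => simp only [map_add, hx, hy, LinearMap.add_comp]
  | tmul j x => ext g; simp

theorem tensorEval_bijective [Module.Free R F] [Module.Finite R F] :
    Function.Bijective (tensorEval R C I F) := by
  let b := Module.Free.chooseBasis R F
  -- The inverse uses the dual basis: the coefficient at `b i` sends `c` to `h` of the rank-one map
  -- `x ↦ b.coord i x • c`.
  let inv : ((F →ₗ[R] C) →ₗ[R] I) → (C →ₗ[R] I) ⊗[R] F := fun h =>
    ∑ i, (h ∘ₗ LinearMap.smulRightₗ (b.coord i)) ⊗ₜ[R] b i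
  refine Function.bijective_iff_has_inverse.2 ⟨inv, fun t => ?_, fun h => ?_⟩
  · have hadd (x y) : inv (x + y) = inv x + inv y := by
      simp [inv, LinearMap.add_comp, TensorProduct.add_tmul, Finset.sum_add_distrib]
    induction t with
    | zero => simp [inv]
    | add x y hx hy => rw [map_add, hadd, hx, hy]
    | tmul j x =>
      have : ∀ i, tensorEval R C I F (j ⊗ₜ x) ∘ₗ LinearMap.smulRightₗ (b.coord i) =
          b.repr x i • j := by
        intro i
        ext c
        simp
      simp only [inv, this, TensorProduct.smul_tmul, ← TensorProduct.tmul_sum, b.sum_repr]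
  · ext g
    have hg : g = ∑ i, (b.coord i).smulRight (g (b i)) := by
      refine b.ext fun k => ?_
      simp [LinearMap.sum_apply, Finsupp.single_apply]
    conv_rhs => rw [hg, map_sum]
    simp [inv, LinearMap.sum_apply]

end TensorEval

/-! ### Exactness of tensor products and Hom -/

section Seq

variable {F : ℕ → ModuleCat.{u} R} {d : ∀ n, F (n + 1) ⟶ F n}

theorem HomToExactSeq.function_exact {N : ModuleCat.{u} R} (h : IsExactSeq F d)
    (hN : HomToExactSeq F d N) (n : ℕ) :
    Function.Exact (LinearMap.lcomp R N (d n).hom) (LinearMap.lcomp R N (d (n + 1)).hom) := by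
  refine fun φ => ⟨fun hφ => ?_, ?_⟩
  · obtain ⟨ψ, hψ⟩ := hN n (ModuleCat.ofHom φ) (ModuleCat.hom_ext hφ)
    exact ⟨ψ.hom, congrArg ModuleCat.Hom.hom hψ⟩
  · rintro ⟨ψ, rfl⟩
    ext x
    change ψ (d n (d (n + 1) x)) = 0
    rw [(h.exact n).apply_apply_eq_zero, map_zero]

theorem IsExactSeq.lTensor (h : IsExactSeq F d) (P : Type u) [AddCommGroup P] [Module R P]
    [Module.Flat R P] : IsExactSeq (fun n => ModuleCat.of R (P ⊗[R] F n))
      (fun n => ModuleCat.ofHom ((d n).hom.lTensor P)) where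
  surjective := LinearMap.lTensor_surjective P h.surjective
  exact n := Module.Flat.lTensor_exact P (h.exact n)

/-- For finite free `F n` one has `Hom(F n, Q ⊗ C) ≅ Q ⊗ Hom(F n, C)`, and tensoring with the flat
module `Q` preserves exactness. -/
theorem HomToExactSeq.tensor_right {C : ModuleCat.{u} R} (h : IsExactSeq F d)
    (hF : ∀ n, finiteFree R (F (n + 1))) (hC : HomToExactSeq F d C) (Q : Type u) [AddCommGroup Q]
    [Module R Q] [Module.Flat R Q] : HomToExactSeq F d (ModuleCat.of R (Q ⊗[R] C)) := by
  intro n φ hφ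
  have := (hF n).1
  have := (hF n).2
  have := (hF (n + 1)).1
  have := (hF (n + 1)).2
  have hnat {A B : Type u} [AddCommGroup A] [Module R A] [AddCommGroup B] [Module R B]
      (f : A →ₗ[R] B) (t : Q ⊗[R] (B →ₗ[R] C)) :
      TensorProduct.lTensorHomToHomLTensor (.id R) A Q C ((LinearMap.lcomp R C f).lTensor Q t) =
        TensorProduct.lTensorHomToHomLTensor (.id R) B Q C t ∘ₗ f := by
    induction t with
    | zero => simp
    | add x y hx hy => simp only [map_add, hx, hy, LinearMap.add_comp]
    | tmul q g => ext x; simp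
  obtain ⟨t, ht⟩ := (lTensorHomEquivHomLTensor R (F (n + 1)) Q C).surjective φ.hom
  rw [lTensorHomEquivHomLTensor_apply] at ht
  obtain ⟨s, rfl⟩ := (Module.Flat.lTensor_exact Q (hC.function_exact h n) t).1 (by
    refine (lTensorHomEquivHomLTensor R (F (n + 2)) Q C).injective ?_
    rw [lTensorHomEquivHomLTensor_apply, hnat, ht, map_zero]
    exact congrArg ModuleCat.Hom.hom hφ)
  -- At `F n` only the natural map is needed, not its bijectivity; this allows `n = 0`, where `F 0`
  -- need not be free.
  refine ⟨ModuleCat.ofHom (TensorProduct.lTensorHomToHomLTensor (.id R) (F n) Q C s), ?_⟩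
  rw [hnat] at ht
  exact ModuleCat.hom_ext ht

/-- By adjunction `Hom(P ⊗ F, N)` is `Hom(P, Hom(F, N))`, and `Hom(P, -)` is exact. -/
theorem HomToExactSeq.lTensor {N : ModuleCat.{u} R} (h : IsExactSeq F d)
    (hN : HomToExactSeq F d N) (P : Type u) [AddCommGroup P] [Module R P] [Module.Projective R P] :
    HomToExactSeq (fun n => ModuleCat.of R (P ⊗[R] F n))
      (fun n => ModuleCat.ofHom ((d n).hom.lTensor P)) N := by
  intro n φ hφ
  obtain ⟨ψ, hψ⟩ := exists_comp_eq_of_projective (hN.function_exact h n)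
    (TensorProduct.curry φ.hom) (by
      ext p x
      exact congrArg (fun t => t.hom (p ⊗ₜ x)) hφ)
  refine ⟨ModuleCat.ofHom (TensorProduct.lift ψ), ModuleCat.hom_ext (TensorProduct.ext' ?_)⟩
  intro p x
  exact LinearMap.congr_fun (LinearMap.congr_fun hψ p) x

theorem IsExactSeq.homInjective (h : IsExactSeq F d) (I : Type u) [AddCommGroup I] [Module R I]
    [Module.Injective R I] : IsExactCoseq (fun n => ModuleCat.of R (F n →ₗ[R] I))
      (fun n => ModuleCat.ofHom (LinearMap.lcomp R I (d n).hom)) where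
  injective f g hfg := LinearMap.ext fun x => by
    obtain ⟨y, rfl⟩ := h.surjective x
    exact LinearMap.congr_fun hfg y
  exact n φ := by
    refine ⟨fun hφ => exists_comp_eq_of_injective (h.exact n) φ hφ, ?_⟩
    rintro ⟨ψ, rfl⟩
    refine LinearMap.ext fun x => ?_
    exact (congrArg ψ ((h.exact n).apply_apply_eq_zero x)).trans (map_zero ψ)

/-- Tensor evaluation identifies `Hom(C, I) ⊗ F` with `Hom(Hom(F, C), I)` on the finite free terms,
and `Hom(-, I)` preserves the exactness of `Hom(F, C)`. -/
theorem HomToExactSeq.lTensor_hom_exact {C : ModuleCat.{u} R} (h : IsExactSeq F d)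
    (hF : ∀ n, finiteFree R (F (n + 1))) (hC : HomToExactSeq F d C) (I : Type u) [AddCommGroup I]
    [Module R I] [Module.Injective R I] (n : ℕ) :
    Function.Exact ((d (n + 1)).hom.lTensor (C →ₗ[R] I)) ((d n).hom.lTensor (C →ₗ[R] I)) := by
  have := (hF n).1
  have := (hF n).2
  have := (hF (n + 1)).1
  have := (hF (n + 1)).2
  refine fun t => ⟨fun ht => ?_, ?_⟩
  · obtain ⟨k, hk⟩ := exists_comp_eq_of_injective (hC.function_exact h n)
      (tensorEval R C I (F (n + 1)) t) (by rw [← tensorEval_lTensor, ht, map_zero])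
    obtain ⟨s, rfl⟩ := (tensorEval_bijective (R := R) (C := C) (I := I) (F := F (n + 2))).2 k
    refine ⟨s, tensorEval_bijective.1 ?_⟩
    rw [tensorEval_lTensor, hk]
  · rintro ⟨s, rfl⟩
    rw [← LinearMap.comp_apply, ← LinearMap.lTensor_comp]
    have : (d n).hom ∘ₗ (d (n + 1)).hom = 0 := (h.exact n).linearMap_comp_eq_zero
    rw [this]; simp

/-- Swapping arguments, `Hom(Hom(C, J), Hom(F, I))` is `Hom(Hom(C, J) ⊗ F, I)`, so the exactness of
`Hom(C, J) ⊗ F` is transported by the injective `I`. -/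
theorem HomToExactSeq.homFromExactCoseq {C : ModuleCat.{u} R} (h : IsExactSeq F d)
    (hF : ∀ n, finiteFree R (F (n + 1))) (hC : HomToExactSeq F d C) (I J : Type u)
    [AddCommGroup I] [Module R I] [Module.Injective R I]
    [AddCommGroup J] [Module R J] [Module.Injective R J] :
    HomFromExactCoseq (fun n => ModuleCat.of R (F n →ₗ[R] I))
      (fun n => ModuleCat.ofHom (LinearMap.lcomp R I (d n).hom)) (ModuleCat.of R (C →ₗ[R] J)) := by
  intro n φ hφ
  obtain ⟨ψ, hψ⟩ := exists_comp_eq_of_injective (hC.lTensor_hom_exact h hF J n)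
    (TensorProduct.lift φ.hom) (by
      refine TensorProduct.ext' fun j x => ?_
      exact congrArg (fun t => t.hom j x) hφ)
  refine ⟨ModuleCat.ofHom (TensorProduct.curry ψ), ModuleCat.hom_ext (LinearMap.ext fun j =>
    LinearMap.ext fun x => LinearMap.congr_fun hψ (j ⊗ₜ x))⟩

end Seq

end HomTensor

section ModuleClasses

open TensorProduct

/-! ### Extending sequences to complexes indexed by `ℤ` -/

/-- The modules of the two-sided sequence with `X n` in position `n - 1`, and zero below. -/
def extendX (X : ℕ → ModuleCat.{u} R) : ℤ → ModuleCat.{u} R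
  | Int.ofNat n => X (n + 1)
  | Int.negSucc 0 => X 0
  | Int.negSucc (_ + 1) => ModuleCat.of R PUnit

theorem extendX_subsingleton (X : ℕ → ModuleCat.{u} R) : ∀ i : ℤ, i < -1 → Subsingleton (extendX X i)
  | Int.ofNat n, h => absurd h (by simp)
  | Int.negSucc 0, h => absurd h (by simp)
  | Int.negSucc (n + 1), _ => inferInstanceAs (Subsingleton PUnit)

section Chain

variable {X : ℕ → ModuleCat.{u} R} {d : ∀ n, X (n + 1) ⟶ X n}

/-- The differentials `extendX X (i + 1) ⟶ extendX X i`. -/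
def extendD (d : ∀ n, X (n + 1) ⟶ X n) : ∀ i : ℤ, extendX X (i + 1) ⟶ extendX X i
  | Int.ofNat n => d (n + 1)
  | Int.negSucc 0 => d 0
  | Int.negSucc (_ + 1) => 0

theorem extendD_comp (h : IsExactSeq X d) : ∀ i : ℤ, extendD d (i + 1) ≫ extendD d i = 0
  | Int.ofNat n => comp_eq_zero_of_exact (h.exact (n + 1))
  | Int.negSucc 0 => comp_eq_zero_of_exact (h.exact 0)
  | Int.negSucc (_ + 1) => comp_zero

/-- The chain complex `⋯ ⟶ X 1 ⟶ X 0 ⟶ 0 ⟶ ⋯` with `X 0` in degree `-1`. -/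
noncomputable def extendComplex (h : IsExactSeq X d) : ChainComplex (ModuleCat.{u} R) ℤ :=
  ChainComplex.of (extendX X) (extendD d) (extendD_comp h)

theorem extendComplex_d (h : IsExactSeq X d) (i : ℤ) :
    (extendComplex h).d (i + 1) i = extendD d i :=
  ChainComplex.of_d ..

theorem extendD_exact (h : IsExactSeq X d) :
    ∀ i : ℤ, Function.Exact (extendD d (i + 1)) (extendD d i)
  | Int.ofNat n => h.exact (n + 1)
  | Int.negSucc 0 => h.exact 0
  | Int.negSucc 1 => fun x => ⟨fun _ => h.surjective x, fun _ => rfl⟩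
  | Int.negSucc (n + 2) => fun x =>
    have := extendX_subsingleton X (Int.negSucc (n + 2) + 1) (by omega)
    ⟨fun _ => ⟨0, this.elim _ _⟩, fun _ => rfl⟩

theorem extendComplex_acyclic (h : IsExactSeq X d) : (extendComplex h).Acyclic := by
  intro i
  obtain ⟨i, rfl⟩ : ∃ j, j + 1 = i := ⟨i - 1, by ring⟩
  refine (exactAt_iff_forall _ (i := i + 1 + 1) (k := i) (by simp) (by simp)).2 ?_
  rw [extendComplex_d, extendComplex_d]
  exact fun x hx => (extendD_exact h i x).1 hx

theorem extendD_homTo {N : ModuleCat.{u} R} (h : IsExactSeq X d) (hN : HomToExactSeq X d N) :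
    ∀ (i : ℤ) (φ : extendX X (i + 1) ⟶ N), extendD d (i + 1) ≫ φ = 0 →
      ∃ ψ : extendX X i ⟶ N, extendD d i ≫ ψ = φ
  | Int.ofNat n => hN (n + 1)
  | Int.negSucc 0 => hN 0
  | Int.negSucc 1 => fun φ hφ => by
    have : Epi (extendD d (Int.negSucc 1 + 1)) := (ModuleCat.epi_iff_surjective _).2 h.surjective
    exact ⟨0, by rw [comp_zero, ← cancel_epi (extendD d (Int.negSucc 1 + 1)), hφ, comp_zero]⟩
  | Int.negSucc (n + 2) => fun φ _ => by
    have := extendX_subsingleton X (Int.negSucc (n + 2) + 1) (by omega)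
    exact ⟨0, (ModuleCat.isZero_of_subsingleton _).eq_of_src _ _⟩

theorem extendComplex_homTo_acyclic {N : ModuleCat.{u} R} (h : IsExactSeq X d)
    (hN : HomToExactSeq X d N) : (homTo (extendComplex h) N).Acyclic := by
  intro i
  obtain ⟨i, rfl⟩ : ∃ j, j + 1 = i := ⟨i - 1, by ring⟩
  refine (homTo_exactAt_iff _ N (i := i + 1 + 1) (k := i) (by simp) (by simp)).2 ?_
  rw [extendComplex_d, extendComplex_d]
  exact extendD_homTo h hN i

/-- The term `X 0` of the exact sequence `X` is the cokernel of the preceding differential. -/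
theorem nonempty_iso_cokernel_extendComplex (h : IsExactSeq X d) :
    Nonempty (X 0 ≅ cokernel ((extendComplex h).d 1 0)) := by
  have hd : (extendComplex h).d 1 0 = d 1 := extendComplex_d h 0
  rw [hd]
  have hex : (ShortComplex.mk (d 1) (d 0) (comp_eq_zero_of_exact (h.exact 0))).Exact :=
    (ShortComplex.moduleCat_exact_iff _).2 fun x hx => (h.exact 0 x).1 hx
  have : Epi (d 0) := (ModuleCat.epi_iff_surjective _).2 h.surjective
  exact ⟨hex.gIsCokernel.coconePointUniqueUpToIso (colimit.isColimit _)⟩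

end Chain

section Cochain

variable {X : ℕ → ModuleCat.{u} R} {d : ∀ n, X n ⟶ X (n + 1)}

/-- The differentials `extendX X i ⟶ extendX X (i + 1)`. -/
def coextendD (d : ∀ n, X n ⟶ X (n + 1)) : ∀ i : ℤ, extendX X i ⟶ extendX X (i + 1)
  | Int.ofNat n => d (n + 1)
  | Int.negSucc 0 => d 0
  | Int.negSucc (_ + 1) => 0

theorem coextendD_comp (h : IsExactCoseq X d) : ∀ i : ℤ, coextendD d i ≫ coextendD d (i + 1) = 0
  | Int.ofNat n => comp_eq_zero_of_exact (h.exact (n + 1))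
  | Int.negSucc 0 => comp_eq_zero_of_exact (h.exact 0)
  | Int.negSucc (_ + 1) => zero_comp

/-- The cochain complex `⋯ ⟶ 0 ⟶ X 0 ⟶ X 1 ⟶ ⋯` with `X 0` in degree `-1`. -/
noncomputable def coextendComplex (h : IsExactCoseq X d) : CochainComplex (ModuleCat.{u} R) ℤ :=
  CochainComplex.of (extendX X) (coextendD d) (coextendD_comp h)

theorem coextendComplex_d (h : IsExactCoseq X d) (i : ℤ) :
    (coextendComplex h).d i (i + 1) = coextendD d i :=
  CochainComplex.of_d ..

theorem coextendD_exact (h : IsExactCoseq X d) :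
    ∀ i : ℤ, Function.Exact (coextendD d i) (coextendD d (i + 1))
  | Int.ofNat n => h.exact (n + 1)
  | Int.negSucc 0 => h.exact 0
  | Int.negSucc 1 => exact_of_comp_eq_zero zero_comp fun x hx =>
      ⟨0, h.injective (by rw [map_zero]; exact ((map_zero (d 0).hom).trans hx.symm))⟩
  | Int.negSucc (n + 2) => exact_of_comp_eq_zero zero_comp fun x _ =>
    have := extendX_subsingleton X (Int.negSucc (n + 2) + 1) (by omega)
    ⟨0, this.elim _ _⟩

theorem coextendComplex_acyclic (h : IsExactCoseq X d) : (coextendComplex h).Acyclic := by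
  intro i
  obtain ⟨i, rfl⟩ : ∃ j, j + 1 = i := ⟨i - 1, by ring⟩
  refine (exactAt_iff_forall _ (i := i) (k := i + 1 + 1) (by simp) (by simp)).2 ?_
  rw [coextendComplex_d, coextendComplex_d]
  exact fun x hx => (coextendD_exact h i x).1 hx

theorem coextendD_homFrom {M : ModuleCat.{u} R} (h : IsExactCoseq X d)
    (hM : HomFromExactCoseq X d M) :
    ∀ (i : ℤ) (φ : M ⟶ extendX X (i + 1)), φ ≫ coextendD d (i + 1) = 0 →
      ∃ ψ : M ⟶ extendX X i, ψ ≫ coextendD d i = φ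
  | Int.ofNat n => hM (n + 1)
  | Int.negSucc 0 => hM 0
  | Int.negSucc 1 => fun φ hφ => by
    have : Mono (coextendD d (Int.negSucc 1 + 1)) :=
      (ModuleCat.mono_iff_injective _).2 h.injective
    exact ⟨0, by rw [zero_comp, ← cancel_mono (coextendD d (Int.negSucc 1 + 1)), hφ, zero_comp]⟩
  | Int.negSucc (n + 2) => fun φ _ => by
    have := extendX_subsingleton X (Int.negSucc (n + 2) + 1) (by omega)
    exact ⟨0, (ModuleCat.isZero_of_subsingleton _).eq_of_tgt _ _⟩

theorem coextendComplex_homFrom_acyclic {M : ModuleCat.{u} R} (h : IsExactCoseq X d)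
    (hM : HomFromExactCoseq X d M) : (homFrom M (coextendComplex h)).Acyclic := by
  intro i
  obtain ⟨i, rfl⟩ : ∃ j, j + 1 = i := ⟨i - 1, by ring⟩
  refine (homFrom_exactAt_iff M _ (i := i) (k := i + 1 + 1) (by simp) (by simp)).2 ?_
  rw [coextendComplex_d, coextendComplex_d]
  exact coextendD_homFrom h hM i

/-- The term `X 0` of the exact sequence `X` is the kernel of the second differential. -/
theorem nonempty_iso_kernel_coextendComplex (h : IsExactCoseq X d) :
    Nonempty (X 0 ≅ kernel ((coextendComplex h).d 0 1)) := by
  have hd : (coextendComplex h).d 0 1 = d 1 := coextendComplex_d h 0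
  rw [hd]
  have hex : (ShortComplex.mk (d 0) (d 1) (comp_eq_zero_of_exact (h.exact 0))).Exact :=
    (ShortComplex.moduleCat_exact_iff _).2 fun x hx => (h.exact 0 x).1 hx
  have : Mono (d 0) := (ModuleCat.mono_iff_injective _).2 h.injective
  exact ⟨hex.fIsKernel.conePointUniqueUpToIso (limit.isLimit _)⟩

end Cochain

/-! ### `C`-projective and Gorenstein projective modules -/

section Classes

variable {C : ModuleCat.{u} R}

theorem HomToExactSeq.of_iso {X : ℕ → ModuleCat.{u} R} {d : ∀ n, X (n + 1) ⟶ X n}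
    {N N' : ModuleCat.{u} R} (e : N ≅ N') (h : HomToExactSeq X d N) : HomToExactSeq X d N' := by
  intro n φ hφ
  obtain ⟨ψ, hψ⟩ := h n (φ ≫ e.inv) (by rw [← Category.assoc, hφ, zero_comp])
  exact ⟨ψ ≫ e.hom, by rw [← Category.assoc, hψ, Category.assoc, e.inv_hom_id, Category.comp_id]⟩

theorem HomFromExactCoseq.of_iso {X : ℕ → ModuleCat.{u} R} {d : ∀ n, X n ⟶ X (n + 1)}
    {M M' : ModuleCat.{u} R} (e : M ≅ M') (h : HomFromExactCoseq X d M) :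
    HomFromExactCoseq X d M' := by
  intro n φ hφ
  obtain ⟨ψ, hψ⟩ := h n (e.hom ≫ φ) (by rw [Category.assoc, hφ, comp_zero])
  exact ⟨e.inv ≫ ψ, by rw [Category.assoc, hψ, e.inv_hom_id_assoc]⟩

theorem cProjective_punit : cProjective C (ModuleCat.of R PUnit) :=
  ⟨ModuleCat.of R PUnit, inferInstanceAs (Module.Projective R PUnit.{u + 1}),
    ⟨LinearEquiv.ofSubsingleton PUnit.{u + 1} (PUnit.{u + 1} ⊗[R] C)⟩⟩

theorem cInjective_punit : cInjective C (ModuleCat.of R PUnit) :=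
  ⟨ModuleCat.of R PUnit, ⟨fun _ _ _ _ _ _ _ _ _ => ⟨0, fun _ => rfl⟩⟩,
    ⟨LinearEquiv.ofSubsingleton PUnit.{u + 1} (C →ₗ[R] PUnit.{u + 1})⟩⟩

/-- A free resolution of a semidualizing module, as an exact and `Hom(-, C)`-exact sequence. -/
theorem IsSemidualizing.exists_seq (hC : IsSemidualizing C) :
    ∃ (F : ℕ → ModuleCat.{u} R) (d : ∀ n, F (n + 1) ⟶ F n), F 0 = C ∧ IsExactSeq F d ∧
      (∀ n, finiteFree R (F (n + 1))) ∧ HomToExactSeq F d C := by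
  obtain ⟨F⟩ := hC.resolution
  have h := isExactSeq_of_acyclic F.exact
  refine ⟨_, _, rfl, h, F.mem, h.homToExactSeq ?_⟩
  rintro (_ | n)
  · exact fun n => hC.ext_eq_zero (n + 1) (by omega)
  · have := (F.mem n).1
    exact ExtVanish.of_projective (F.complex.X n) C

theorem cProjective_le_gcProjective (hC : IsSemidualizing C) :
    cProjective C ≤ gcProjective C := by
  rintro X ⟨P, hP, ⟨e⟩⟩
  obtain ⟨F, d, rfl, h, hF, hd⟩ := hC.exists_seq
  have hPF := h.lTensor P
  obtain ⟨i⟩ := nonempty_iso_cokernel_extendComplex hPF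
  refine ⟨extendComplex hPF, ⟨extendComplex_acyclic hPF, ?_, ?_, ?_⟩, ⟨e.toModuleIso ≪≫ i⟩⟩
  · rintro Q ⟨Q', hQ', ⟨e'⟩⟩
    exact extendComplex_homTo_acyclic hPF
      (((hd.tensor_right h hF Q').lTensor h P).of_iso e'.symm.toModuleIso)
  · rintro (n | n) hn
    · have := (hF n).1
      exact inferInstanceAs (Module.Projective R (P ⊗[R] F (n + 1)))
    · exact absurd hn (by simp)
  · rintro (n | _ | n) hn
    -- Among negative degrees only `-1` carries a term other than zero by construction, namely `P ⊗
    -- F 0` with `F 0` in the role of `C`.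
    · exact absurd hn (by simp)
    · exact ⟨P, hP, ⟨LinearEquiv.refl R _⟩⟩
    · exact cProjective_punit

theorem cInjective_le_gcInjective (hC : IsSemidualizing C) :
    cInjective C ≤ gcInjective C := by
  rintro X ⟨I, hI, ⟨e⟩⟩
  obtain ⟨F, d, rfl, h, hF, hd⟩ := hC.exists_seq
  have hFI := h.homInjective I
  obtain ⟨i⟩ := nonempty_iso_kernel_coextendComplex hFI
  refine ⟨coextendComplex hFI, ⟨coextendComplex_acyclic hFI, ?_, ?_, ?_⟩, ⟨e.toModuleIso ≪≫ i⟩⟩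
  · rintro J ⟨J', hJ', ⟨e'⟩⟩
    exact coextendComplex_homFrom_acyclic hFI
      ((hd.homFromExactCoseq h hF I J').of_iso e'.symm.toModuleIso)
  · rintro (n | n) hn
    · have := (hF n).1
      exact injective_linearMap_of_flat (F (n + 1)) I
    · exact absurd hn (by simp)
  · rintro (n | _ | n) hn
    · exact absurd hn (by simp)
    · exact ⟨I, hI, ⟨LinearEquiv.refl R _⟩⟩
    · exact cInjective_punit

/-- The sequence `⋯ ⟶ X 1 ⟶ X 0 ⟶ G`. -/
def augmentSeq (X : ℕ → ModuleCat.{u} R) (G : ModuleCat.{u} R) : ℕ → ModuleCat.{u} R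
  | 0 => G
  | n + 1 => X n

/-- The terms of the complete resolution in degrees `≥ 0` form a projective resolution of `G` that
`Hom(-, Q)` keeps exact. -/
theorem gcProjective.extVanish {G Q : ModuleCat.{u} R} (hG : gcProjective C G)
    (hQ : cProjective C Q) : ExtVanish G Q := by
  obtain ⟨X, hX, ⟨e⟩⟩ := hG
  let π : X.X 0 ⟶ G := cokernel.π (X.d 1 0) ≫ e.inv
  have hπ : X.d 1 0 ≫ π = 0 := by simp [π]
  have hπe : π ≫ e.hom = cokernel.π (X.d 1 0) := by simp [π]
  let d : ∀ n, augmentSeq (fun n => X.X (n : ℤ)) G (n + 1) ⟶ augmentSeq (fun n => X.X (n : ℤ)) G n :=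
    fun n => match n with
    | 0 => π
    | n + 1 => X.d ((n + 1 : ℕ) : ℤ) (n : ℤ)
  have hprev (n : ℕ) : (ComplexShape.down ℤ).prev ((n + 1 : ℕ) : ℤ) = ((n + 2 : ℕ) : ℤ) := by
    simp; ring
  have hnext (n : ℕ) : (ComplexShape.down ℤ).next ((n + 1 : ℕ) : ℤ) = (n : ℤ) := by
    simp
  have hepi : Epi π := by infer_instance
  have hexact : IsExactSeq _ d := by
    refine ⟨(ModuleCat.epi_iff_surjective π).1 hepi, ?_⟩
    rintro (_ | n)
    · have hex : (ShortComplex.mk (X.d 1 0) (cokernel.π (X.d 1 0)) (by simp)).Exact :=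
        ShortComplex.exact_cokernel _
      rw [ShortComplex.moduleCat_exact_iff] at hex
      refine exact_of_comp_eq_zero hπ fun (x : X.X 0) (hx : π x = 0) => hex x ?_
      change cokernel.π (X.d 1 0) x = 0
      rw [← hπe, ModuleCat.comp_apply, hx, map_zero]
    · exact exact_of_comp_eq_zero (X.d_comp_d _ _ _)
        ((exactAt_iff_forall X (hprev n) (hnext n)).1 (hX.exact _))
  refine HomToExactSeq.extVanish_zero (d := d) ?_ hexact fun n => ?_
  · rintro (_ | n) φ hφ
    -- At `X 0` the augmented sequence continues to `G` instead of `X.X (-1)`, so the cokernel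
    -- property replaces the exactness of `Hom(X, Q)`.
    · refine ⟨e.hom ≫ cokernel.desc (X.d 1 0) φ hφ, ?_⟩
      change π ≫ e.hom ≫ cokernel.desc (X.d 1 0) φ hφ = φ
      rw [← Category.assoc, hπe]
      exact cokernel.π_desc ..
    · exact (homTo_exactAt_iff X Q (hprev n) (hnext n)).1 (hX.homExact Q hQ _) φ hφ
  · have := hX.projective (n : ℤ) (by simp)
    exact ExtVanish.of_projective (X.X (n : ℤ)) Q

theorem gcInjective.extVanish {G J : ModuleCat.{u} R} (hG : gcInjective C G)
    (hJ : cInjective C J) : ExtVanish J G := by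
  obtain ⟨Y, hY, ⟨e⟩⟩ := hG
  let ι : G ⟶ Y.X 0 := e.hom ≫ kernel.ι (Y.d 0 1)
  have hι : ι ≫ Y.d 0 1 = 0 := by simp [ι]
  have heι : e.inv ≫ ι = kernel.ι (Y.d 0 1) := by simp [ι]
  let d : ∀ n, augmentSeq (fun n => Y.X (n : ℤ)) G n ⟶ augmentSeq (fun n => Y.X (n : ℤ)) G (n + 1) :=
    fun n => match n with
    | 0 => ι
    | n + 1 => Y.d (n : ℤ) ((n + 1 : ℕ) : ℤ)
  have hnext (n : ℕ) : (ComplexShape.up ℤ).next ((n + 1 : ℕ) : ℤ) = ((n + 2 : ℕ) : ℤ) := by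
    simp; ring
  have hprev (n : ℕ) : (ComplexShape.up ℤ).prev ((n + 1 : ℕ) : ℤ) = (n : ℤ) := by
    simp
  have hmono : Mono ι := by infer_instance
  have hexact : IsExactCoseq _ d := by
    refine ⟨(ModuleCat.mono_iff_injective ι).1 hmono, ?_⟩
    rintro (_ | n)
    · have hex : (ShortComplex.mk (kernel.ι (Y.d 0 1)) (Y.d 0 1) (by simp)).Exact :=
        ShortComplex.exact_kernel _
      rw [ShortComplex.moduleCat_exact_iff] at hex
      refine exact_of_comp_eq_zero hι fun y hy => ?_
      obtain ⟨z, rfl⟩ := hex y hy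
      exact ⟨e.inv z, congrArg (fun t => t.hom z) heι⟩
    · exact exact_of_comp_eq_zero (Y.d_comp_d _ _ _)
        ((exactAt_iff_forall Y (hprev n) (hnext n)).1 (hY.exact _))
  refine HomFromExactCoseq.extVanish_zero (d := d) ?_ hexact fun n => ?_
  · rintro (_ | n) φ hφ
    · refine ⟨kernel.lift (Y.d 0 1) φ hφ ≫ e.inv, ?_⟩
      change (kernel.lift (Y.d 0 1) φ hφ ≫ e.inv) ≫ ι = φ
      rw [Category.assoc, heι]
      exact kernel.lift_ι ..
    · exact (homFrom_exactAt_iff J Y (hprev n) (hnext n)).1 (hY.homExact J hJ _) φ hφ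
  · have := hY.injective (n : ℤ) (by simp)
    exact ExtVanish.of_injective J (Y.X (n : ℤ))

theorem gcProjective.extVanish_of_finitePd {G N : ModuleCat.{u} R} (hG : gcProjective C G)
    (hN : FinitePd (cProjective C) N) : ExtVanish G N := by
  obtain ⟨X, m, hm⟩ := hN
  -- Augmentation puts `N` in position `0` and shifts the resolution by one, hence `m + 1`.
  refine (isExactSeq_of_acyclic X.exact).extVanish_of_isZero (m := m + 1)
    (fun n => hG.extVanish (X.mem n)) ?_
  rintro (_ | n) hn
  · simp at hn
  · exact hm n (by omega)

theorem gcInjective.extVanish_of_finiteId {G M : ModuleCat.{u} R} (hG : gcInjective C G)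
    (hM : FiniteId (cInjective C) M) : ExtVanish M G := by
  obtain ⟨Y, m, hm⟩ := hM
  refine (isExactCoseq_of_acyclic Y.exact).extVanish_of_isZero (m := m + 1)
    (fun n => hG.extVanish (Y.mem n)) ?_
  rintro (_ | n) hn
  · simp at hn
  · exact hm n (by omega)

end Classes

end ModuleClasses

end RelCohomology

theorem proposition3p4 {R : Type u} [CommRing R] (C M N : ModuleCat.{u} R)
    (hC : RelCohomology.IsSemidualizing C) :
    (∀ (G : RelCohomology.ProperResolution (RelCohomology.gcProjective C) M)
       (W : RelCohomology.ProperResolution (RelCohomology.cProjective C) M),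
       RelCohomology.FinitePd (RelCohomology.cProjective C) N →
       ∀ n : ℕ, ∃ θ : RelCohomology.extLeft G N n ⟶ RelCohomology.extLeft W N n,
         RelCohomology.IsTheta G W N n θ ∧ IsIso θ) ∧
    (∀ (H : RelCohomology.ProperCoresolution (RelCohomology.gcInjective C) N)
       (V : RelCohomology.ProperCoresolution (RelCohomology.cInjective C) N),
       RelCohomology.FiniteId (RelCohomology.cInjective C) M →
       ∀ n : ℕ, ∃ θ : RelCohomology.extRight M H n ⟶ RelCohomology.extRight M V n,
         RelCohomology.IsCotheta M H V n θ ∧ IsIso θ) :=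
  ⟨fun G W hN => RelCohomology.exists_isTheta_isIso (RelCohomology.cProjective_le_gcProjective hC)
      (fun _ hX => hX.extVanish_of_finitePd hN) G W,
    fun H V hM => RelCohomology.exists_isCotheta_isIso (RelCohomology.cInjective_le_gcInjective hC)
      (fun _ hY => hY.extVanish_of_finiteId hM) H V⟩
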